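/- Let $\mathbb K$ be a field of characteristic zero, $G$ an abelian group (written additively) and $\varepsilon:G\times G\to\mathbb K^\times$ an antisymmetric bicharacter, i.e. $\varepsilon(g,h)\varepsilon(h,g)=1$, $\varepsilon(g,h+k)=\varepsilon(g,h)\varepsilon(g,k)$ and $\varepsilon(g+h,k)=\varepsilon(g,k)\varepsilon(h,k)$. Let $L=\bigoplus_{g\in G}L_g$ be a $G$-graded $\varepsilon$-Lie algebra (color Lie algebra) over $\mathbb K$: a graded vector space with a bilinear bracket such that $[L_g,L_h]\subseteq L_{g+h}$ and, for homogeneous $a,b,c$, $[a,b]=-\varepsilon(|a|,|b|)[b,a]$ and $$\varepsilon(|c|,|a|)[a,[b,c]]+\varepsilon(|a|,|b|)[b,[c,a]]+\varepsilon(|b|,|c|)[c,[a,b]]=0.$$ Let $\omega:L\times L\to\mathbb K$ be a scalar graded 2-cocycle of degree zero: a bilinear form with $\omega(L_g,L_h)=0$ if $g+h\neq 0$ and, for homogeneous $x,y,z$, $\omega(x,y)=-\varepsilon(|x|,|y|)\omega(y,x)$ and $$\varepsilon(|z|,|x|)\omega(x,[y,z])+\varepsilon(|x|,|y|)\omega(y,[z,x])+\varepsilon(|y|,|z|)\omega(z,[x,y])=0.$$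 Let $U_\omega(L)$ be the generalized enveloping algebra, the quotient of the tensor algebra $T(L)$ by the two-sided ideal generated by the elements $x\otimes y-\varepsilon(|x|,|y|)\,y\otimes x-[x,y]-\omega(x,y)$ with $x,y\in L$ homogeneous, with its induced $G$-grading, and let $U(L)=U_0(L)$ be the universal enveloping algebra of $L$. Let $M$ be a $G$-graded $U_\omega(L)$-bimodule (with $\mathbb K$ acting centrally). Then $$\mathrm{ad}(x)m:=xm-\varepsilon(|x|,|m|)\,mx\qquad(x\in L,\ m\in M\text{ homogeneous})$$ makes $M$ a graded $L$-module ${}^{ad}M$, that is, a graded left $U(L)$-module, and for every $n\ge 0$ there is an isomorphism of $\mathbb K$-vector spaces $$\mathrm H^n_{gr}(L,{}^{ad}M)\;\cong\;\mathrm{HH}^n_{gr}(U_\omega(L),M).$$ Here, for a $G$-graded algebra $A$, $A\text{-gr}$ denotes the abelian category of $G$-graded left $A$-modules and degree-preserving $A$-linear maps; $\mathrm H^n_{gr}(L,N):=\mathrm{Ext}^n_{U(L)\text{-gr}}(\mathbb K,N)$ is the graded cohomology of $L$ with coefficients in a graded $L$-module $N$, where $\mathbb K$ is the trivial module concentrated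 in degree $0$; and $\mathrm{HH}^n_{gr}(A,M):=\mathrm{Ext}^n_{A^e\text{-gr}}(A,M)$ is graded Hochschild cohomology, where $A^e=A\otimes_{\mathbb K}A^{op}$ with $A^e_g=\sum_{h}A_h\otimes A_{g-h}$, acting by $(a\otimes b)m=amb$. -/

import Mathlib

open CategoryTheory CategoryTheory.Limits DirectSum TensorProduct

universe w u v k a

noncomputable section

/-! ### The abelian category of graded modules over a graded algebra -/

section Internal

variable {K : Type*} [Field K] {G : Type*} [DecidableEq G] {N : Type*} [AddCommGroup N] [Module K N]

/-- A family of subspaces that spans and admits compatible projections is a direct sum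
decomposition. -/
theorem isInternal_of_proj (𝒩 : G → Submodule K N) (p : G → N →ₗ[K] N)
    (hp : ∀ g, ∀ n ∈ 𝒩 g, p g n = n) (hp' : ∀ g h, g ≠ h → ∀ n ∈ 𝒩 h, p g n = 0)
    (htop : ⨆ g, 𝒩 g = ⊤) : DirectSum.IsInternal 𝒩 := by
  rw [DirectSum.isInternal_submodule_iff_iSupIndep_and_iSup_eq_top]
  refine ⟨fun g => ?_, htop⟩
  rw [Submodule.disjoint_def]
  intro n hn hn'
  rw [← hp g n hn]
  have : (⨆ j, ⨆ (_ : j ≠ g), 𝒩 j) ≤ LinearMap.ker (p g) :=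
    iSup₂_le fun j hj n hn => hp' g j hj.symm n hn
  exact this hn'

/-- The projections onto the components of an internal direct sum. -/
theorem exists_proj {𝒩 : G → Submodule K N} (h : DirectSum.IsInternal 𝒩) :
    ∃ p : G → N →ₗ[K] N, (∀ g n, p g n ∈ 𝒩 g) ∧ (∀ g, ∀ n ∈ 𝒩 g, p g n = n) ∧
      (∀ g h, g ≠ h → ∀ n ∈ 𝒩 h, p g n = 0) ∧
      (∀ n, ∃ s : Finset G, n = ∑ g ∈ s, p g n) := by
  classical
  let := h.chooseDecomposition
  refine ⟨fun g => (𝒩 g).subtype ∘ₗ DirectSum.component K G (fun i => 𝒩 i) g ∘ₗ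
    (DirectSum.decomposeLinearEquiv 𝒩).toLinearMap, fun g n => ?_, fun g n hn => ?_,
    fun g h hgh n hn => ?_, fun n => ?_⟩
  · exact Subtype.property _
  · exact DirectSum.decompose_of_mem_same 𝒩 hn
  · exact DirectSum.decompose_of_mem_ne 𝒩 hn hgh.symm
  · exact ⟨_, (DirectSum.sum_support_decompose 𝒩 n).symm⟩

/-- A direct sum decomposition passes to quotients by subspaces that are stable under the
projections. -/
theorem isInternal_map {Q : Type*} [AddCommGroup Q] [Module K Q] (𝒩 : G → Submodule K N)
    {π : N →ₗ[K] Q} (q : G → N →ₗ[K] N) (hq : ∀ g, ∀ n ∈ 𝒩 g, q g n = n)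
    (hq' : ∀ g h, g ≠ h → ∀ n ∈ 𝒩 h, q g n = 0) (htop : ⨆ g, 𝒩 g = ⊤)
    (hπ : Function.Surjective π) (hker : ∀ g n, π n = 0 → π (q g n) = 0) :
    DirectSum.IsInternal fun g => (𝒩 g).map π := by
  let e := π.quotKerEquivOfSurjective hπ
  let r : G → Q →ₗ[K] Q := fun g =>
    e.toLinearMap ∘ₗ (LinearMap.ker π).mapQ (LinearMap.ker π) (q g) (hker g) ∘ₗ e.symm.toLinearMap
  have hr : ∀ g n, r g (π n) = π (q g n) := fun g n => by
    have : e.symm (π n) = Submodule.Quotient.mk n := by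
      rw [LinearEquiv.symm_apply_eq]; rfl
    simp only [r, LinearMap.comp_apply, LinearEquiv.coe_coe, this]
    rfl
  refine isInternal_of_proj _ r ?_ ?_ ?_
  · rintro g _ ⟨n, hn, rfl⟩
    rw [hr, hq g n hn]
  · rintro g h hgh _ ⟨n, hn, rfl⟩
    rw [hr, hq' g h hgh n hn, map_zero]
  · rw [← Submodule.map_iSup, htop, Submodule.map_top, LinearMap.range_eq_top]
    exact hπ

/-- The grading induced on the quotient of a module by a submodule stable under projections. -/
theorem isInternal_mkQ {A : Type*} [Ring A] [Algebra K A] [Module A N] [IsScalarTower K A N]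
    (S : Submodule A N) (𝒩 : G → Submodule K N) (q : G → N →ₗ[K] N)
    (hq : ∀ g, ∀ n ∈ 𝒩 g, q g n = n)
    (hq' : ∀ g h, g ≠ h → ∀ n ∈ 𝒩 h, q g n = 0) (htop : ⨆ g, 𝒩 g = ⊤) (hker : ∀ g, ∀ n ∈ S, q g n ∈ S) :
    DirectSum.IsInternal fun g => (𝒩 g).map (S.mkQ.restrictScalars K) := by
  have h1 : Function.Surjective (S.mkQ.restrictScalars K) := S.mkQ_surjective
  have h2 : ∀ g n, (S.mkQ.restrictScalars K) n = 0 → (S.mkQ.restrictScalars K) (q g n) = 0 := by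
    intro g n hn
    rw [LinearMap.restrictScalars_apply, Submodule.mkQ_apply, Submodule.Quotient.mk_eq_zero] at hn ⊢
    exact hker g n hn
  exact isInternal_map 𝒩 q hq hq' htop h1 h2

end Internal

section Category

variable {K : Type k} [Field K] {G : Type w} [AddCommGroup G] [DecidableEq G]
  {A : Type a} [Ring A] [Algebra K A]

/-- Graded left modules over the `G`-graded `K`-algebra `A` with homogeneous components `𝒜 g`. -/
structure GrMod (𝒜 : G → Submodule K A) where
  carrier : Type v
  [addCommGroup : AddCommGroup carrier]
  [moduleBase : Module K carrier]
  [module : Module A carrier]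
  [isScalarTower : IsScalarTower K A carrier]
  /-- the homogeneous components -/
  deg : G → Submodule K carrier
  isInternal : DirectSum.IsInternal deg
  smul_mem : ∀ {g h : G} {a : A} {m : carrier}, a ∈ 𝒜 g → m ∈ deg h → a • m ∈ deg (g + h)

namespace GrMod

attribute [instance] addCommGroup moduleBase module isScalarTower

variable {𝒜 : G → Submodule K A}

/-- Morphisms of graded modules: `A`-linear maps that preserve degrees. -/
@[ext]
structure Hom (M N : GrMod.{w, v} 𝒜) where
  toLin : M.carrier →ₗ[A] N.carrier
  map_mem : ∀ {g : G} {m : M.carrier}, m ∈ M.deg g → toLin m ∈ N.deg g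

instance : Category.{v} (GrMod.{w, v} 𝒜) where
  Hom M N := Hom M N
  id M := ⟨LinearMap.id, fun h => h⟩
  comp f g := ⟨g.toLin ∘ₗ f.toLin, fun h => g.map_mem (f.map_mem h)⟩

variable {M N P : GrMod.{w, v} 𝒜}

/-- The underlying linear map of a morphism. -/
def lin (f : M ⟶ N) : M.carrier →ₗ[A] N.carrier := Hom.toLin f

theorem lin_mem (f : M ⟶ N) {g : G} {m : M.carrier} (h : m ∈ M.deg g) : lin f m ∈ N.deg g :=
  Hom.map_mem f h

/-- Constructor for morphisms. -/
def ofLin (f : M.carrier →ₗ[A] N.carrier) (h : ∀ g, ∀ m ∈ M.deg g, f m ∈ N.deg g) : M ⟶ N :=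
  Hom.mk f (fun {g m} hm => h g m hm)

@[simp] theorem lin_ofLin (f : M.carrier →ₗ[A] N.carrier) (h) : lin (ofLin (M := M) f h) = f := rfl
@[simp] theorem lin_id : lin (𝟙 M) = LinearMap.id := rfl
@[simp] theorem lin_comp (f : M ⟶ N) (g : N ⟶ P) : lin (f ≫ g) = lin g ∘ₗ lin f := rfl

theorem hom_ext {f g : M ⟶ N} (h : lin f = lin g) : f = g := Hom.ext h

instance : Zero (M ⟶ N) := ⟨ofLin 0 fun _ _ _ => Submodule.zero_mem _⟩
instance : Add (M ⟶ N) :=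
  ⟨fun f g => ofLin (lin f + lin g) fun _ _ h => Submodule.add_mem _ (lin_mem f h) (lin_mem g h)⟩
instance : Neg (M ⟶ N) :=
  ⟨fun f => ofLin (-lin f) fun _ _ h => Submodule.neg_mem _ (lin_mem f h)⟩
instance : Sub (M ⟶ N) :=
  ⟨fun f g => ofLin (lin f - lin g) fun _ _ h => Submodule.sub_mem _ (lin_mem f h) (lin_mem g h)⟩
instance : SMul K (M ⟶ N) :=
  ⟨fun k f => ofLin (k • lin f) fun _ _ h => Submodule.smul_mem _ k (lin_mem f h)⟩

instance : AddCommGroup (M ⟶ N) where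
  add_assoc _ _ _ := hom_ext (add_assoc _ _ _)
  zero_add _ := hom_ext (zero_add _)
  add_zero _ := hom_ext (add_zero _)
  add_comm _ _ := hom_ext (add_comm _ _)
  neg_add_cancel _ := hom_ext (neg_add_cancel _)
  sub_eq_add_neg _ _ := hom_ext (sub_eq_add_neg _ _)
  nsmul := nsmulRec
  zsmul := zsmulRec

@[simp] theorem lin_zero : lin (0 : M ⟶ N) = 0 := rfl
@[simp] theorem lin_add (f g : M ⟶ N) : lin (f + g) = lin f + lin g := rfl
@[simp] theorem lin_smul (k : K) (f : M ⟶ N) : lin (k • f) = k • lin f := rfl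

instance : Preadditive (GrMod.{w, v} 𝒜) where
  add_comp _ _ _ _ _ _ := hom_ext <| by simp [LinearMap.comp_add]
  comp_add _ _ _ _ _ _ := hom_ext <| by simp [LinearMap.add_comp]

instance : Module K (M ⟶ N) :=
  Function.Injective.module K ⟨⟨lin, rfl⟩, fun _ _ => rfl⟩ (fun _ _ => hom_ext) (fun _ _ => rfl)

instance : Linear K (GrMod.{w, v} 𝒜) where
  homModule _ _ := inferInstance
  smul_comp M N P k f g := hom_ext <| by
    ext m
    exact LinearMap.map_smul_of_tower (lin g) k (lin f m)
  comp_smul _ _ _ _ _ _ := hom_ext <| by ext m; simp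

theorem iSup_deg (M : GrMod.{w, v} 𝒜) : ⨆ g, M.deg g = ⊤ :=
  M.isInternal.submodule_iSup_eq_top

/-- Morphisms commute with the projections onto the homogeneous components. -/
theorem exists_proj_comm (f : M ⟶ N) : ∃ (p : G → M.carrier →ₗ[K] M.carrier)
    (q : G → N.carrier →ₗ[K] N.carrier),
      (∀ g m, p g m ∈ M.deg g) ∧ (∀ g, ∀ m ∈ M.deg g, p g m = m) ∧
      (∀ g h, g ≠ h → ∀ m ∈ M.deg h, p g m = 0) ∧ (∀ m, ∃ s : Finset G, m = ∑ g ∈ s, p g m) ∧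
      (∀ g n, q g n ∈ N.deg g) ∧ (∀ g, ∀ n ∈ N.deg g, q g n = n) ∧
      (∀ g h, g ≠ h → ∀ n ∈ N.deg h, q g n = 0) ∧ (∀ n, ∃ s : Finset G, n = ∑ g ∈ s, q g n) ∧
      (∀ g m, lin f (p g m) = q g (lin f m)) := by
  obtain ⟨p, p1, p2, p3, p4⟩ := exists_proj M.isInternal
  obtain ⟨q, q1, q2, q3, q4⟩ := exists_proj N.isInternal
  refine ⟨p, q, p1, p2, p3, p4, q1, q2, q3, q4, fun g m => ?_⟩
  have hm : m ∈ ⨆ h, M.deg h := by rw [iSup_deg]; trivial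
  induction hm using Submodule.iSup_induction' with
  | zero => simp
  | add x y _ _ hx hy => simp [hx, hy]
  | mem h m hm =>
    by_cases hgh : g = h
    · subst hgh
      rw [p2 g m hm, q2 g _ (lin_mem f hm)]
    · rw [p3 g h hgh m hm, q3 g h hgh _ (lin_mem f hm), map_zero]

/-- The kernel of a morphism. -/
def ker (f : M ⟶ N) : GrMod.{w, v} 𝒜 where
  carrier := LinearMap.ker (lin f)
  deg g := (M.deg g).comap ((LinearMap.ker (lin f)).subtype.restrictScalars K)
  isInternal := by
    obtain ⟨p, q, p1, p2, p3, p4, -, -, -, -, pq⟩ := exists_proj_comm f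
    have hk : ∀ g, ∀ m : LinearMap.ker (lin f), p g m ∈ LinearMap.ker (lin f) := fun g m => by
      rw [LinearMap.mem_ker, pq, LinearMap.mem_ker.1 m.2, map_zero]
    let r : G → LinearMap.ker (lin f) →ₗ[K] LinearMap.ker (lin f) := fun g =>
      { toFun := fun m => ⟨p g m, hk g m⟩
        map_add' := fun x y => Subtype.ext (by simp)
        map_smul' := fun k x => Subtype.ext (by simp) }
    refine isInternal_of_proj _ r (fun g m hm => Subtype.ext (p2 g m hm))
      (fun g h hgh m hm => Subtype.ext (p3 g h hgh m hm)) ?_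
    rw [eq_top_iff]
    intro m _
    obtain ⟨s, hs⟩ := p4 m
    have : m = ∑ g ∈ s, r g m := Subtype.ext (by rw [AddSubmonoidClass.coe_finsetSum]; exact hs)
    rw [this]
    exact Submodule.sum_mem _ fun g _ => Submodule.mem_iSup_of_mem g (p1 g m)
  smul_mem ha hm := M.smul_mem ha hm

/-- The inclusion of the kernel. -/
def kerι (f : M ⟶ N) : ker f ⟶ M := ofLin (M := ker f) (LinearMap.ker (lin f)).subtype
  fun _ _ h => h

theorem kerι_comp (f : M ⟶ N) : kerι f ≫ f = 0 := hom_ext <| by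
  ext m
  exact m.2

/-- The kernel has the universal property. -/
def kerIsLimit (f : M ⟶ N) : IsLimit (KernelFork.ofι (kerι f) (kerι_comp f)) :=
  KernelFork.IsLimit.ofι _ _
    (fun {W'} g hg => ofLin (N := ker f) ((lin g).codRestrict _ fun m => by
      have := congrArg (fun h => lin h m) hg
      exact this) fun _ _ h => lin_mem g h)
    (fun _ _ => rfl)
    (fun {W'} g hg m hm => hom_ext <| LinearMap.ext fun x => Subtype.ext <|
      congrArg (fun h => lin h x) hm)

theorem coker_isInternal (f : M ⟶ N) : DirectSum.IsInternal fun g =>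
    (N.deg g).map ((LinearMap.range (lin f)).mkQ.restrictScalars K) := by
  obtain ⟨p, q, p1, p2, p3, p4, q1, q2, q3, q4, pq⟩ := exists_proj_comm f
  refine isInternal_mkQ (LinearMap.range (lin f)) N.deg q q2 q3 (iSup_deg N) fun g n hn => ?_
  obtain ⟨m, rfl⟩ := hn
  exact ⟨p g m, pq g m⟩

/-- The cokernel of a morphism. -/
def coker (f : M ⟶ N) : GrMod.{w, v} 𝒜 where
  carrier := N.carrier ⧸ LinearMap.range (lin f)
  deg g := (N.deg g).map ((LinearMap.range (lin f)).mkQ.restrictScalars K)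
  isInternal := coker_isInternal f
  smul_mem := by
    rintro g h a _ ha ⟨n, hn, rfl⟩
    exact ⟨a • n, N.smul_mem ha hn, rfl⟩

/-- The projection onto the cokernel. -/
def cokerπ (f : M ⟶ N) : N ⟶ coker f := ofLin (N := coker f) (LinearMap.range (lin f)).mkQ
  fun _ n h => ⟨n, h, rfl⟩

theorem comp_cokerπ (f : M ⟶ N) : f ≫ cokerπ f = 0 :=
  hom_ext <| LinearMap.range_mkQ_comp _

/-- The cokernel has the universal property. -/
def cokerIsColimit (f : M ⟶ N) : IsColimit (CokernelCofork.ofπ (cokerπ f) (comp_cokerπ f)) :=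
  CokernelCofork.IsColimit.ofπ _ _
    (fun {Z'} g hg => ofLin (M := coker f) ((LinearMap.range (lin f)).liftQ (lin g) (by
      rintro _ ⟨m, rfl⟩
      exact congrArg (fun h => lin h m) hg)) (by
        rintro _ _ ⟨n, hn, rfl⟩
        exact lin_mem g hn))
    (fun _ _ => rfl)
    (fun {Z'} g hg m hm => hom_ext <| by
      apply Submodule.linearMap_qext
      exact congrArg lin hm)

instance : HasKernels (GrMod.{w, v} 𝒜) where
  has_limit f := ⟨⟨⟨_, kerIsLimit f⟩⟩⟩

instance : HasCokernels (GrMod.{w, v} 𝒜) where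
  has_colimit f := ⟨⟨⟨_, cokerIsColimit f⟩⟩⟩

/-- The zero module. -/
def zeroObj (𝒜 : G → Submodule K A) : GrMod.{w, v} 𝒜 where
  carrier := PUnit
  deg _ := ⊤
  isInternal := isInternal_of_proj _ (fun _ => 0) (fun _ _ _ => rfl) (fun _ _ _ _ _ => rfl)
    (Subsingleton.elim _ _)
  smul_mem _ _ := trivial

instance : HasZeroObject (GrMod.{w, v} 𝒜) where
  zero := ⟨zeroObj 𝒜, by
    rw [IsZero.iff_id_eq_zero]
    exact hom_ext (LinearMap.ext fun _ => rfl)⟩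

/-- The direct sum of two graded modules. -/
def prod (M N : GrMod.{w, v} 𝒜) : GrMod.{w, v} 𝒜 where
  carrier := M.carrier × N.carrier
  deg g := (M.deg g).prod (N.deg g)
  isInternal := by
    obtain ⟨p, p1, p2, p3, p4⟩ := exists_proj M.isInternal
    obtain ⟨q, q1, q2, q3, q4⟩ := exists_proj N.isInternal
    refine isInternal_of_proj _ (fun g => (p g).prodMap (q g)) (fun g x hx => ?_)
      (fun g h hgh x hx => ?_) ?_
    · exact Prod.ext (p2 g _ hx.1) (q2 g _ hx.2)
    · exact Prod.ext (p3 g h hgh _ hx.1) (q3 g h hgh _ hx.2)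
    · rw [eq_top_iff]
      rintro ⟨m, n⟩ -
      have h1 : ∀ m, (m, 0) ∈ ⨆ g, (M.deg g).prod (N.deg g) := fun m => by
        obtain ⟨s, hs⟩ := p4 m
        have : ((m, 0) : M.carrier × N.carrier) = ∑ g ∈ s, (p g m, 0) := by
          rw [Prod.ext_iff, Prod.fst_sum, Prod.snd_sum]
          exact ⟨hs, by simp⟩
        rw [this]
        exact Submodule.sum_mem _ fun g _ =>
          Submodule.mem_iSup_of_mem g ⟨p1 g m, Submodule.zero_mem _⟩
      have h2 : ∀ n, (0, n) ∈ ⨆ g, (M.deg g).prod (N.deg g) := fun n => by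
        obtain ⟨s, hs⟩ := q4 n
        have : ((0, n) : M.carrier × N.carrier) = ∑ g ∈ s, (0, q g n) := by
          rw [Prod.ext_iff, Prod.fst_sum, Prod.snd_sum]
          exact ⟨by simp, hs⟩
        rw [this]
        exact Submodule.sum_mem _ fun g _ =>
          Submodule.mem_iSup_of_mem g ⟨Submodule.zero_mem _, q1 g n⟩
      have := Submodule.add_mem _ (h1 m) (h2 n)
      simpa using this
  smul_mem ha hm := ⟨M.smul_mem ha hm.1, N.smul_mem ha hm.2⟩

instance : HasBinaryBiproducts (GrMod.{w, v} 𝒜) :=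
  ⟨fun M N => hasBinaryBiproduct_of_total
    { pt := prod M N
      fst := ofLin (M := prod M N) (LinearMap.fst A M.carrier N.carrier) fun _ _ h => h.1
      snd := ofLin (M := prod M N) (LinearMap.snd A M.carrier N.carrier) fun _ _ h => h.2
      inl := ofLin (N := prod M N) (LinearMap.inl A M.carrier N.carrier) fun _ _ h =>
        ⟨h, Submodule.zero_mem _⟩
      inr := ofLin (N := prod M N) (LinearMap.inr A M.carrier N.carrier) fun _ _ h =>
        ⟨Submodule.zero_mem _, h⟩
      inl_fst := hom_ext (LinearMap.ext fun _ => rfl)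
      inl_snd := hom_ext (LinearMap.ext fun _ => rfl)
      inr_fst := hom_ext (LinearMap.ext fun _ => rfl)
      inr_snd := hom_ext (LinearMap.ext fun _ => rfl) }
    (hom_ext (LinearMap.ext fun x => Prod.ext (add_zero x.1) (zero_add x.2)))⟩

instance : HasFiniteProducts (GrMod.{w, v} 𝒜) := hasFiniteProducts_of_has_binary_and_terminal

theorem injective_of_mono (f : M ⟶ N) [Mono f] : Function.Injective (lin f) := by
  rw [← LinearMap.ker_eq_bot, Submodule.eq_bot_iff]
  intro m hm
  have h : kerι f = 0 := by
    rw [← cancel_mono f, kerι_comp, zero_comp]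
  exact congrArg (fun k => lin k (show (ker f).carrier from (⟨m, hm⟩ : LinearMap.ker (lin f)))) h

theorem surjective_of_epi (f : M ⟶ N) [Epi f] : Function.Surjective (lin f) := by
  rw [← LinearMap.range_eq_top, eq_top_iff]
  intro n _
  have h : cokerπ f = 0 := by
    rw [← cancel_epi f, comp_cokerπ, comp_zero]
  exact (Submodule.Quotient.mk_eq_zero (LinearMap.range (lin f))).1
    (congrArg (fun k => lin k n) h)

/-- An injective morphism reflects homogeneity. -/
theorem mem_of_injective (f : M ⟶ N) (hf : Function.Injective (lin f)) {g : G} {m : M.carrier}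
    (h : lin f m ∈ N.deg g) : m ∈ M.deg g := by
  obtain ⟨p, q, p1, -, -, -, -, q2, -, -, pq⟩ := exists_proj_comm f
  have : p g m = m := hf (by rw [pq, q2 g _ h])
  rw [← this]
  exact p1 g m

/-- Homogeneous elements lift along surjective morphisms. -/
theorem exists_of_surjective (f : M ⟶ N) (hf : Function.Surjective (lin f)) {g : G}
    {n : N.carrier} (h : n ∈ N.deg g) : ∃ m ∈ M.deg g, lin f m = n := by
  obtain ⟨p, q, p1, -, -, -, -, q2, -, -, pq⟩ := exists_proj_comm f
  obtain ⟨m, rfl⟩ := hf n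
  exact ⟨p g m, p1 g m, by rw [pq, q2 g _ h]⟩

/-- Every monomorphism is the kernel of its cokernel. -/
theorem normalMono (f : M ⟶ N) [Mono f] : Nonempty (NormalMono f) := ⟨{
  Z := coker f
  g := cokerπ f
  w := comp_cokerπ f
  isLimit := KernelFork.IsLimit.ofι _ _
    (fun {W'} g hg => ofLin
      ((LinearEquiv.ofInjective (lin f) (injective_of_mono f)).symm.toLinearMap ∘ₗ
        (lin g).codRestrict (LinearMap.range (lin f)) fun m =>
          (Submodule.Quotient.mk_eq_zero (LinearMap.range (lin f))).1
            (congrArg (fun k => lin k m) hg))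
      fun d m hm => by
        apply mem_of_injective f (injective_of_mono f)
        have := congrArg Subtype.val ((LinearEquiv.ofInjective (lin f)
          (injective_of_mono f)).apply_symm_apply ((lin g).codRestrict (LinearMap.range (lin f))
          (fun m => (Submodule.Quotient.mk_eq_zero (LinearMap.range (lin f))).1
            (congrArg (fun k => lin k m) hg)) m))
        rw [LinearEquiv.ofInjective_apply] at this
        exact this ▸ lin_mem g hm)
    (fun {W'} g hg => hom_ext <| LinearMap.ext fun m =>
      congrArg Subtype.val ((LinearEquiv.ofInjective (lin f)
          (injective_of_mono f)).apply_symm_apply ((lin g).codRestrict (LinearMap.range (lin f))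
          (fun m => (Submodule.Quotient.mk_eq_zero (LinearMap.range (lin f))).1
            (congrArg (fun k => lin k m) hg)) m)))
    (fun {W'} g hg m hm => by
      rw [← cancel_mono f, hm]
      exact hom_ext <| LinearMap.ext fun m =>
        (congrArg Subtype.val ((LinearEquiv.ofInjective (lin f)
          (injective_of_mono f)).apply_symm_apply ((lin g).codRestrict (LinearMap.range (lin f))
          (fun m => (Submodule.Quotient.mk_eq_zero (LinearMap.range (lin f))).1
            (congrArg (fun k => lin k m) hg)) m))).symm) }⟩

/-- Every epimorphism is the cokernel of its kernel. -/
theorem normalEpi (f : M ⟶ N) [Epi f] : Nonempty (NormalEpi f) := ⟨{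
  W := ker f
  g := kerι f
  w := kerι_comp f
  isColimit :=
    let e := (lin f).quotKerEquivOfSurjective (surjective_of_epi f)
    have he : ∀ m, e.symm (lin f m) = Submodule.Quotient.mk m := fun m => by
      rw [LinearEquiv.symm_apply_eq]; rfl
    have hl : ∀ {Z' : GrMod.{w, v} 𝒜} (g : M ⟶ Z'), kerι f ≫ g = 0 →
        LinearMap.ker (lin f) ≤ LinearMap.ker (lin g) := fun g hg m hm =>
      congrArg (fun k => lin k (show (ker f).carrier from (⟨m, hm⟩ : LinearMap.ker (lin f)))) hg
    CokernelCofork.IsColimit.ofπ _ _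
      (fun {Z'} g hg => ofLin
        ((LinearMap.ker (lin f)).liftQ (lin g) (hl g hg) ∘ₗ e.symm.toLinearMap)
        fun d n hn => by
          obtain ⟨m, hm, rfl⟩ := exists_of_surjective f (surjective_of_epi f) hn
          rw [LinearMap.comp_apply, LinearEquiv.coe_coe, he]
          exact lin_mem g hm)
      (fun {Z'} g hg => hom_ext <| LinearMap.ext fun m => by
        rw [lin_comp, lin_ofLin, LinearMap.comp_apply, LinearMap.comp_apply, LinearEquiv.coe_coe,
          he]
        rfl)
      (fun {Z'} g hg m hm => by
        rw [← cancel_epi f, hm]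
        exact (hom_ext <| LinearMap.ext fun m => by
          rw [lin_comp, lin_ofLin, LinearMap.comp_apply, LinearMap.comp_apply,
            LinearEquiv.coe_coe, he]
          rfl)) }⟩

instance : Abelian (GrMod.{w, v} 𝒜) where
  normalMonoOfMono f _ := normalMono f
  normalEpiOfEpi f _ := normalEpi f

instance : HasExt.{max (v + 1) w k a} (GrMod.{w, v} 𝒜) := HasExt.standard (GrMod.{w, v} 𝒜)

end GrMod

end Category
/-! ### Graded bimodules and graded Hochschild cohomology -/

section Bimodules

variable {K : Type u} [Field K] {G : Type w} [AddCommGroup G] [DecidableEq G]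
  {A : Type u} [Ring A] [Algebra K A]

/-- The grading of the enveloping algebra `A ⊗ Aᵒᵖ`: its component of degree `g` is the sum over
`h` of the images of `A_h ⊗ A_{g - h}`. -/
def envGrading (𝒜 : G → Submodule K A) (g : G) : Submodule K (A ⊗[K] Aᵐᵒᵖ) :=
  ⨆ h : G, Submodule.map₂ (TensorProduct.mk K A Aᵐᵒᵖ) (𝒜 h)
    ((𝒜 (g - h)).map (MulOpposite.opLinearEquiv K).toLinearMap)

/-- Graded bimodules over the `G`-graded `K`-algebra `A`; the right action of `a` is the left action
of `MulOpposite.op a`, and both actions induce the given action of `K`. -/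
structure GrBimod (𝒜 : G → Submodule K A) where
  carrier : Type u
  [addCommGroup : AddCommGroup carrier]
  [moduleBase : Module K carrier]
  [moduleLeft : Module A carrier]
  [moduleRight : Module Aᵐᵒᵖ carrier]
  [towerLeft : IsScalarTower K A carrier]
  [towerRight : IsScalarTower K Aᵐᵒᵖ carrier]
  [comm : SMulCommClass A Aᵐᵒᵖ carrier]
  /-- the homogeneous components -/
  deg : G → Submodule K carrier
  isInternal : DirectSum.IsInternal deg
  smul_mem : ∀ {g h : G} {a : A} {m : carrier}, a ∈ 𝒜 g → m ∈ deg h → a • m ∈ deg (g + h)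
  op_smul_mem : ∀ {g h : G} {a : A} {m : carrier}, a ∈ 𝒜 g → m ∈ deg h →
    MulOpposite.op a • m ∈ deg (h + g)

namespace GrBimod

attribute [instance] addCommGroup moduleBase moduleLeft moduleRight towerLeft towerRight comm

variable {𝒜 : G → Submodule K A}

/-- A graded bimodule as a graded left module over the enveloping algebra:
`(a ⊗ b) m = a m b`. -/
def toGrMod (M : GrBimod 𝒜) : GrMod.{w, u} (envGrading 𝒜) :=
  letI : Module (A ⊗[K] Aᵐᵒᵖ) M.carrier := TensorProduct.Algebra.module
  { carrier := M.carrier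
    isScalarTower := ⟨fun k t m => by
      change TensorProduct.Algebra.moduleAux (k • t) m = k • TensorProduct.Algebra.moduleAux t m
      rw [map_smul, LinearMap.smul_apply]⟩
    deg := M.deg
    isInternal := M.isInternal
    smul_mem := fun {g h t m} ht hm => by
      have hle : envGrading 𝒜 g ≤ (M.deg (g + h)).comap
          ((TensorProduct.Algebra.moduleAux (R := K) (A := A) (B := Aᵐᵒᵖ) (M := M.carrier)).flip
            m) := by
        refine iSup_le fun i => Submodule.map₂_le.2 ?_
        rintro a ha _ ⟨b, hb, rfl⟩
        change a • (MulOpposite.op b) • m ∈ M.deg (g + h)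
        have := M.smul_mem ha (M.op_smul_mem hb hm)
        rwa [show i + (h + (g - i)) = g + h by abel] at this
      exact hle ht }

/-- The algebra `A` as a graded bimodule over itself. -/
def regular (𝒜 : G → Submodule K A) [GradedAlgebra 𝒜] : GrBimod 𝒜 where
  carrier := A
  deg := 𝒜
  isInternal := DirectSum.Decomposition.isInternal 𝒜
  smul_mem ha hm := SetLike.mul_mem_graded ha hm
  op_smul_mem ha hm := SetLike.mul_mem_graded hm ha

end GrBimod

/-- Graded Hochschild cohomology of the graded algebra `A` with values in the graded bimodule `M`,
`Ext` in the category of graded modules over `A ⊗ Aᵒᵖ`. -/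
abbrev GrHH (𝒜 : G → Submodule K A) [GradedAlgebra 𝒜] (M : GrBimod 𝒜) (n : ℕ) :
    Type (max (u + 1) w) :=
  Abelian.Ext (GrBimod.regular 𝒜).toGrMod M.toGrMod n

end Bimodules

/-! ### Color Lie algebras and their generalized enveloping algebras -/

/-- Antisymmetric bicharacters on the (additively written) abelian group `G` with values in `Kˣ`. -/
structure Bicharacter (G : Type w) [AddCommGroup G] (K : Type u) [Field K] where
  toFun : G → G → Kˣ
  antisymm : ∀ g h, toFun g h * toFun h g = 1
  map_add_right : ∀ g h k, toFun g (h + k) = toFun g h * toFun g k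
  map_add_left : ∀ g h k, toFun (g + h) k = toFun g k * toFun h k

namespace Bicharacter

variable {G : Type w} [AddCommGroup G] {K : Type u} [Field K]

/-- The value of a bicharacter as an element of `K`. -/
def val (ε : Bicharacter G K) (g h : G) : K := ε.toFun g h

instance : CoeFun (Bicharacter G K) fun _ => G → G → K := ⟨val⟩

variable (ε : Bicharacter G K)

theorem mul_swap (g h : G) : ε g h * ε h g = 1 := by
  rw [val, val, ← Units.val_mul, ε.antisymm, Units.val_one]

theorem add_right (g h k : G) : ε g (h + k) = ε g h * ε g k := by
  rw [val, ε.map_add_right, Units.val_mul, val, val]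

theorem add_left (g h k : G) : ε (g + h) k = ε g k * ε h k := by
  rw [val, ε.map_add_left, Units.val_mul, val, val]

theorem zero_left (k : G) : ε 0 k = 1 := by
  have h := ε.map_add_left 0 0 k
  rw [add_zero] at h
  rw [val, left_eq_mul.1 h, Units.val_one]

end Bicharacter

section Color

variable {K : Type u} [Field K] {G : Type w} [AddCommGroup G] [DecidableEq G]
  {ε : Bicharacter G K} {L : Type u} [AddCommGroup L] [Module K L]
  {ℒ : G → Submodule K L} [DirectSum.Decomposition ℒ]

/-- A color Lie algebra (`G`-graded `ε`-Lie algebra) structure on the graded vector space `L`. -/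
structure ColorLieAlgebra (ε : Bicharacter G K) (ℒ : G → Submodule K L)
    [DirectSum.Decomposition ℒ] where
  bracket : L →ₗ[K] L →ₗ[K] L
  bracket_mem : ∀ {g h : G} {a b : L}, a ∈ ℒ g → b ∈ ℒ h → bracket a b ∈ ℒ (g + h)
  antisymm : ∀ {g h : G} {a b : L}, a ∈ ℒ g → b ∈ ℒ h → bracket a b = -(ε g h • bracket b a)
  jacobi : ∀ {g h k : G} {a b c : L}, a ∈ ℒ g → b ∈ ℒ h → c ∈ ℒ k →
    ε k g • bracket a (bracket b c) + ε g h • bracket b (bracket c a) +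
      ε h k • bracket c (bracket a b) = 0

namespace ColorLieAlgebra

/-- Scalar graded 2-cocycles of degree zero: `ε`-antisymmetric bilinear forms on `L` that vanish on
`L_g × L_h` unless `g + h = 0` and satisfy the cocycle identity. -/
structure Cocycle (𝔤 : ColorLieAlgebra ε ℒ) where
  form : L →ₗ[K] L →ₗ[K] K
  degree_zero : ∀ {g h : G} {x y : L}, x ∈ ℒ g → y ∈ ℒ h → g + h ≠ 0 → form x y = 0
  antisymm : ∀ {g h : G} {x y : L}, x ∈ ℒ g → y ∈ ℒ h → form x y = -(ε g h * form y x)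
  cocycle : ∀ {g h k : G} {x y z : L}, x ∈ ℒ g → y ∈ ℒ h → z ∈ ℒ k →
    ε k g * form x (𝔤.bracket y z) + ε g h * form y (𝔤.bracket z x) +
      ε h k * form z (𝔤.bracket x y) = 0

variable (𝔤 : ColorLieAlgebra ε ℒ)

instance : Zero 𝔤.Cocycle where
  zero :=
    { form := 0
      degree_zero := fun _ _ _ => rfl
      antisymm := fun _ _ => by simp
      cocycle := fun _ _ _ => by simp }

variable {𝔤} (ω : 𝔤.Cocycle)

/-- The defining relations `x ⊗ y = ε(|x|,|y|) y ⊗ x + [x,y] + ω(x,y)` of the generalized enveloping algebra. -/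
inductive Rel : TensorAlgebra K L → TensorAlgebra K L → Prop
  | of {g h : G} {x y : L} (hx : x ∈ ℒ g) (hy : y ∈ ℒ h) :
    Rel (TensorAlgebra.ι K x * TensorAlgebra.ι K y)
      (ε g h • (TensorAlgebra.ι K y * TensorAlgebra.ι K x) + TensorAlgebra.ι K (𝔤.bracket x y)
        + algebraMap K _ (ω.form x y))

/-- The generalized enveloping algebra `U_ω(L)`: the quotient of the tensor algebra of `L` by the
two-sided ideal generated by the elements `x ⊗ y - ε(|x|,|y|) y ⊗ x - [x,y] - ω(x,y)` with `x, y`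
homogeneous. -/
def U : Type u := RingQuot (Rel ω)

instance : Ring (U ω) := inferInstanceAs (Ring (RingQuot (Rel ω)))

instance : Algebra K (U ω) := inferInstanceAs (Algebra K (RingQuot (Rel ω)))

/-- The quotient map from the tensor algebra to `U_ω(L)`. -/
def toU : TensorAlgebra K L →ₐ[K] U ω := RingQuot.mkAlgHom K (Rel ω)

/-- The canonical map from `L` to `U_ω(L)`. -/
def ι : L →ₗ[K] U ω := (toU ω).toLinearMap ∘ₗ TensorAlgebra.ι K

theorem ι_mul_ι {g h : G} {x y : L} (hx : x ∈ ℒ g) (hy : y ∈ ℒ h) :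
    ι ω x * ι ω y = ε g h • (ι ω y * ι ω x) + ι ω (𝔤.bracket x y)
      + algebraMap K _ (ω.form x y) := by
  have : toU ω _ = toU ω _ := RingQuot.mkAlgHom_rel K (Rel.of (ω := ω) hx hy)
  simp only [map_add, map_mul, map_smul, AlgHom.commutes] at this
  exact this

/-- Algebra homomorphisms out of `U_ω(L)`. -/
def lift {B : Type*} [Semiring B] [Algebra K B] (f : L →ₗ[K] B)
    (hf : ∀ {g h : G} {x y : L}, x ∈ ℒ g → y ∈ ℒ h →
      f x * f y = ε g h • (f y * f x) + f (𝔤.bracket x y) + algebraMap K B (ω.form x y)) :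
    U ω →ₐ[K] B :=
  RingQuot.liftAlgHom K ⟨TensorAlgebra.lift K f, fun _ _ h => by
    cases h with
    | of hx hy =>
      simpa only [map_add, map_mul, map_smul, AlgHom.commutes, TensorAlgebra.lift_ι_apply] using
        hf hx hy⟩

theorem lift_ι {B : Type*} [Semiring B] [Algebra K B] (f : L →ₗ[K] B) (hf) (x : L) :
    lift ω f hf (ι ω x) = f x :=
  (RingQuot.liftAlgHom_mkAlgHom_apply K (TensorAlgebra.lift K f) (s := Rel ω) _ _).trans (TensorAlgebra.lift_ι_apply f x)

theorem hom_ext {B : Type*} [Semiring B] [Algebra K B] {f₁ f₂ : U ω →ₐ[K] B}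
    (h : ∀ x, f₁ (ι ω x) = f₂ (ι ω x)) : f₁ = f₂ := by
  refine RingQuot.ringQuot_ext' K (s := Rel ω) f₁ f₂ ?_
  ext x
  exact h x

/-- `IsMonomial ω g u`: `u` is a product `x₁ ⋯ xₙ` in `U_ω(L)` of homogeneous elements `xᵢ ∈ L` of
degrees `gᵢ` with `g₁ + ⋯ + gₙ = g`. -/
inductive IsMonomial : G → U ω → Prop
  | one : IsMonomial 0 1
  | mul {g h : G} {x : L} {u : U ω} (hx : x ∈ ℒ g) (hu : IsMonomial h u) :
    IsMonomial (g + h) (ι ω x * u)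

/-- The `G`-grading of `U_ω(L)` induced by the grading of the tensor algebra: the component of degree
`g` is spanned by the products of homogeneous elements of `L` of total degree `g`. -/
def grading (g : G) : Submodule K (U ω) := Submodule.span K {u | IsMonomial ω g u}

theorem ι_mem_grading {g : G} {x : L} (hx : x ∈ ℒ g) : ι ω x ∈ grading ω g := by
  have := IsMonomial.mul (ω := ω) hx IsMonomial.one
  rw [add_zero, mul_one] at this
  exact Submodule.subset_span this

instance : SetLike.GradedMonoid (grading ω) where
  one_mem := Submodule.subset_span IsMonomial.one
  mul_mem := by
    intro g h a b ha hb
    have key : ∀ {g : G} {u : U ω}, IsMonomial ω g u → ∀ {h : G} {v : U ω}, IsMonomial ω h v →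
        IsMonomial ω (g + h) (u * v) := by
      intro g u hu
      induction hu with
      | one => intro h v hv; rwa [zero_add, one_mul]
      | mul hx _ ih => intro h v hv; rw [add_assoc, mul_assoc]; exact IsMonomial.mul hx (ih hv)
    have := Submodule.mul_mem_mul ha hb
    rw [grading, grading, Submodule.span_mul_span] at this
    refine Submodule.span_mono ?_ this
    rintro _ ⟨u, hu, v, hv, rfl⟩
    exact key hu hv

/-- Auxiliary map for the decomposition of `U_ω(L)`. -/
def decomposeι : L →ₗ[K] ⨁ g, grading ω g :=
  DirectSum.toModule K G _ (fun g => DirectSum.lof K G (fun g => grading ω g) g ∘ₗ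
    ((ι ω).comp (ℒ g).subtype).codRestrict (grading ω g) fun x => ι_mem_grading ω x.2) ∘ₗ
  (DirectSum.decomposeLinearEquiv ℒ).toLinearMap

theorem decomposeι_apply {g : G} {x : L} (hx : x ∈ ℒ g) :
    decomposeι ω x = DirectSum.of (fun g => grading ω g) g ⟨ι ω x, ι_mem_grading ω hx⟩ := by
  simp only [decomposeι, LinearMap.comp_apply, LinearEquiv.coe_coe,
    DirectSum.decomposeLinearEquiv_apply, DirectSum.decompose_of_mem ℒ hx]
  rw [← DirectSum.lof_eq_of K, DirectSum.toModule_lof]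
  rfl

theorem decomposeι_rel (ω : 𝔤.Cocycle) {g h : G} {x y : L} (hx : x ∈ ℒ g) (hy : y ∈ ℒ h) :
    decomposeι ω x * decomposeι ω y = ε g h • (decomposeι ω y * decomposeι ω x) +
      decomposeι ω (𝔤.bracket x y) + algebraMap K (⨁ g, grading ω g) (ω.form x y) := by
  rw [decomposeι_apply ω hx, decomposeι_apply ω hy, decomposeι_apply ω (𝔤.bracket_mem hx hy),
    DirectSum.of_mul_of, DirectSum.of_mul_of]
  have hω : algebraMap K (⨁ g, grading ω g) (ω.form x y) =
      DirectSum.of (fun g => grading ω g) (g + h)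
        (ω.form x y • ⟨if g + h = 0 then 1 else 0, by
          split_ifs with h0
          · rw [h0]; exact SetLike.GradedOne.one_mem
          · exact Submodule.zero_mem _⟩) := by
    by_cases h0 : g + h = 0
    · rw [DirectSum.algebraMap_apply]
      refine DirectSum.of_eq_of_gradedMonoid_eq (Sigma.subtype_ext h0.symm ?_)
      change _ = ω.form x y • (if g + h = 0 then (1 : U ω) else 0)
      rw [if_pos h0]
      exact Algebra.algebraMap_eq_smul_one (R := K) (A := U ω) (ω.form x y)
    · rw [ω.degree_zero hx hy h0, map_zero, zero_smul, map_zero]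
  have hc : DirectSum.of (fun g => grading ω g) (h + g)
      (GradedMonoid.GMul.mul (A := fun g => grading ω g) ⟨ι ω y, ι_mem_grading ω hy⟩
        ⟨ι ω x, ι_mem_grading ω hx⟩) =
      DirectSum.of (fun g => grading ω g) (g + h)
        ⟨ι ω y * ι ω x, add_comm h g ▸
          SetLike.mul_mem_graded (ι_mem_grading ω hy) (ι_mem_grading ω hx)⟩ :=
    DirectSum.of_eq_of_gradedMonoid_eq (Sigma.subtype_ext (add_comm _ _) rfl)
  rw [hω, hc]
  have hl : ∀ u, DirectSum.of (fun g => grading ω g) (g + h) u =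
      DirectSum.lof K G (fun g => grading ω g) (g + h) u := fun _ => rfl
  simp only [hl]
  rw [← map_smul, ← map_add, ← map_add]
  congr 1
  refine Subtype.ext ?_
  change ι ω x * ι ω y = ε g h • (ι ω y * ι ω x) + ι ω (𝔤.bracket x y)
    + ω.form x y • (if g + h = 0 then 1 else 0)
  rw [ι_mul_ι ω hx hy]
  congr 1
  split_ifs with h0
  · exact Algebra.algebraMap_eq_smul_one (R := K) (A := U ω) (ω.form x y)
  · rw [ω.degree_zero hx hy h0, map_zero, zero_smul]

/-- Auxiliary map for the decomposition of `U_ω(L)`. -/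
def decomposeU : U ω →ₐ[K] ⨁ g, grading ω g :=
  lift ω (decomposeι ω) (decomposeι_rel ω)

instance : GradedAlgebra (grading ω) :=
  GradedAlgebra.ofAlgHom _ (decomposeU ω)
    (hom_ext ω fun x => by
      have hx : x ∈ ⨆ g, ℒ g := by
        rw [(DirectSum.Decomposition.isInternal ℒ).submodule_iSup_eq_top]; trivial
      rw [AlgHom.comp_apply, AlgHom.id_apply, decomposeU, lift_ι]
      induction hx using Submodule.iSup_induction' with
      | zero => simp
      | add x y _ _ hx hy => simp only [map_add, hx, hy]
      | mem g x hx => rw [decomposeι_apply ω hx, DirectSum.coeAlgHom_of])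
    (by
      rintro g ⟨u, hu⟩
      have key : ∀ {g : G} {u : U ω} (hu : IsMonomial ω g u), decomposeU ω u =
          DirectSum.of (fun g => grading ω g) g ⟨u, Submodule.subset_span hu⟩ := by
        intro g u hu
        induction hu with
        | one => rw [map_one]; rfl
        | mul hx _ ih =>
          rw [map_mul, ih, decomposeU, lift_ι, decomposeι_apply ω hx, DirectSum.of_mul_of]
          rfl
      induction hu using Submodule.span_induction with
      | mem u hu => exact key hu
      | zero => rw [map_zero]; exact (map_zero _).symm
      | add u v hu hv ihu ihv => rw [map_add, ihu, ihv, ← map_add]; rfl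
      | smul k u hu ih =>
        rw [map_smul, ih, ← DirectSum.lof_eq_of K, ← DirectSum.lof_eq_of K, ← map_smul]; rfl)

/-- Graded left `(ω, L)`-modules: graded vector spaces `M` with a degree-preserving action of `L`
such that `x (y m) - ε(|x|,|y|) y (x m) = [x,y] m + ω(x,y) m` for homogeneous `x, y`. For `ω = 0`
these are the graded `L`-modules. -/
structure GrRep where
  carrier : Type u
  [addCommGroup : AddCommGroup carrier]
  [moduleBase : Module K carrier]
  /-- the homogeneous components -/
  deg : G → Submodule K carrier
  isInternal : DirectSum.IsInternal deg
  act : L →ₗ[K] Module.End K carrier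
  act_mem : ∀ {g h : G} {x : L} {m : carrier}, x ∈ ℒ g → m ∈ deg h → act x m ∈ deg (g + h)
  act_act : ∀ {g h : G} {x y : L}, x ∈ ℒ g → y ∈ ℒ h → ∀ m : carrier,
    act x (act y m) - ε g h • act y (act x m) = act (𝔤.bracket x y) m + ω.form x y • m

namespace GrRep

attribute [instance] addCommGroup moduleBase

variable {ω}

/-- The action of `U_ω(L)` on an `(ω, L)`-module. -/
def actU (M : GrRep ω) : U ω →ₐ[K] Module.End K M.carrier :=
  lift ω M.act fun hx hy => LinearMap.ext fun m => by
    have := M.act_act hx hy m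
    rw [sub_eq_iff_eq_add', ← add_assoc] at this
    simpa using this

/-- The graded `U_ω(L)`-module that corresponds to a graded `(ω, L)`-module. -/
def toGrMod (M : GrRep ω) : GrMod.{w, u} (grading ω) :=
  letI : Module (U ω) M.carrier := Module.compHom M.carrier M.actU.toRingHom
  { carrier := M.carrier
    isScalarTower := ⟨fun k t m => by
      change M.actU (k • t) m = k • M.actU t m
      rw [map_smul, LinearMap.smul_apply]⟩
    deg := M.deg
    isInternal := M.isInternal
    smul_mem := fun {g h t m} ht hm => by
      have key : ∀ {g : G} {u : U ω}, IsMonomial ω g u → M.actU u m ∈ M.deg (g + h) := by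
        intro g u hu
        induction hu with
        | one => rw [map_one, zero_add]; exact hm
        | mul hx _ ih =>
          rw [map_mul, actU, lift_ι, add_assoc]
          exact M.act_mem hx ih
      have hle : grading ω g ≤ (M.deg (g + h)).comap (M.actU.toLinearMap.flip m) :=
        Submodule.span_le.2 fun u hu => key hu
      exact hle ht }

end GrRep

variable (𝔤) in
/-- The trivial graded `L`-module `K`, concentrated in degree `0`. -/
def trivialRep : GrRep (0 : 𝔤.Cocycle) where
  carrier := K
  deg g := if g = 0 then ⊤ else ⊥
  isInternal := isInternal_of_proj _ (fun g => if g = 0 then LinearMap.id else 0)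
    (fun g n hn => by
      by_cases h : g = 0
      · simp [h]
      · simpa [h, eq_comm] using hn)
    (fun g h hgh n hn => by
      by_cases h0 : g = 0
      · have : h ≠ 0 := fun h1 => hgh (h0.trans h1.symm)
        simpa [h0, this] using hn
      · simp [h0])
    (eq_top_iff.2 fun n _ => Submodule.mem_iSup_of_mem 0 (by simp))
  act := 0
  act_mem _ _ := Submodule.zero_mem _
  act_act _ _ m := by
    change (0 : K) - _ • 0 = 0 + (0 : K) • m
    simp

/-- Graded cohomology of `L` with coefficients in the graded `L`-module `M`: `Ext` from the trivial
module `K` to `M` in the category of graded modules over the enveloping algebra `U(L) = U_0(L)`. -/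
abbrev Cohomology (M : GrRep (0 : 𝔤.Cocycle)) (n : ℕ) : Type (max (u + 1) w) :=
  Abelian.Ext (trivialRep 𝔤).toGrMod M.toGrMod n

section Adjoint

variable {ω} (M : GrBimod (grading ω))

/-- The operator on a graded bimodule that scales the component of degree `h` by `ε g h`. -/
def twist (g : G) : Module.End K M.carrier :=
  letI := M.isInternal.chooseDecomposition
  DirectSum.toModule K G _ (fun h => ε g h • (M.deg h).subtype) ∘ₗ
    (DirectSum.decomposeLinearEquiv M.deg).toLinearMap

theorem twist_apply (g : G) {h : G} {m : M.carrier} (hm : m ∈ M.deg h) :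
    twist M g m = ε g h • m := by
  let := M.isInternal.chooseDecomposition
  simp only [twist, LinearMap.comp_apply, LinearEquiv.coe_coe,
    DirectSum.decomposeLinearEquiv_apply, DirectSum.decompose_of_mem M.deg hm]
  rw [← DirectSum.lof_eq_of K, DirectSum.toModule_lof]
  rfl

/-- The operator `m ↦ ε(|x|,|m|) m x`, extended bilinearly from homogeneous `x` and `m`. -/
def braidedRight : L →ₗ[K] Module.End K M.carrier :=
  DirectSum.toModule K G _ (fun g =>
    (LinearMap.mulRight K (twist M g)) ∘ₗ
      (Algebra.lsmul K K M.carrier (A := (U ω)ᵐᵒᵖ)).toLinearMap ∘ₗ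
      (MulOpposite.opLinearEquiv K).toLinearMap ∘ₗ ι ω ∘ₗ (ℒ g).subtype) ∘ₗ
  (DirectSum.decomposeLinearEquiv ℒ).toLinearMap

theorem braidedRight_apply {g h : G} {x : L} {m : M.carrier} (hx : x ∈ ℒ g) (hm : m ∈ M.deg h) :
    braidedRight M x m = ε g h • MulOpposite.op (ι ω x) • m := by
  simp only [braidedRight, LinearMap.comp_apply, LinearEquiv.coe_coe,
    DirectSum.decomposeLinearEquiv_apply, DirectSum.decompose_of_mem ℒ hx]
  rw [← DirectSum.lof_eq_of K, DirectSum.toModule_lof]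
  change MulOpposite.op (ι ω x) • twist M g m = _
  rw [twist_apply M g hm, smul_comm]

/-- The operator `ad(x) m = x m - ε(|x|,|m|) m x`, extended bilinearly from homogeneous `x` and
`m`. -/
def ad : L →ₗ[K] Module.End K M.carrier :=
  (Algebra.lsmul K K M.carrier (A := U ω)).toLinearMap ∘ₗ ι ω - braidedRight M

theorem ad_apply {g h : G} {x : L} {m : M.carrier} (hx : x ∈ ℒ g) (hm : m ∈ M.deg h) :
    ad M x m = ι ω x • m - ε g h • MulOpposite.op (ι ω x) • m := by
  rw [← braidedRight_apply M hx hm]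
  rfl

theorem ad_mem {g h : G} {x : L} {m : M.carrier} (hx : x ∈ ℒ g) (hm : m ∈ M.deg h) :
    ad M x m ∈ M.deg (g + h) := by
  rw [ad_apply M hx hm]
  refine Submodule.sub_mem _ (M.smul_mem (ι_mem_grading ω hx) hm) (Submodule.smul_mem _ _ ?_)
  rw [add_comm]
  exact M.op_smul_mem (ι_mem_grading ω hx) hm

theorem ad_ad {g h : G} {x y : L} (hx : x ∈ ℒ g) (hy : y ∈ ℒ h) (m : M.carrier) :
    ad M x (ad M y m) - ε g h • ad M y (ad M x m) = ad M (𝔤.bracket x y) m := by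
  have hm : m ∈ ⨆ k, M.deg k := by rw [M.isInternal.submodule_iSup_eq_top]; trivial
  induction hm using Submodule.iSup_induction' with
  | zero => simp
  | add m n _ _ hm hn =>
    simp only [map_add, smul_add, ← hm, ← hn]
    abel
  | mem k m hm =>
    have hsx : ι ω x • m ∈ M.deg (g + k) := M.smul_mem (ι_mem_grading ω hx) hm
    have hsy : ι ω y • m ∈ M.deg (h + k) := M.smul_mem (ι_mem_grading ω hy) hm
    have hox : MulOpposite.op (ι ω x) • m ∈ M.deg (g + k) :=
      add_comm k g ▸ M.op_smul_mem (ι_mem_grading ω hx) hm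
    have hoy : MulOpposite.op (ι ω y) • m ∈ M.deg (h + k) :=
      add_comm k h ▸ M.op_smul_mem (ι_mem_grading ω hy) hm
    rw [ad_apply M hx hm, ad_apply M hy hm, ad_apply M (𝔤.bracket_mem hx hy) hm]
    simp only [map_sub, map_smul, ad_apply M hx hsy, ad_apply M hx hoy, ad_apply M hy hsx,
      ad_apply M hy hox]
    have e1 : ι ω (𝔤.bracket x y) = ι ω x * ι ω y - ε g h • (ι ω y * ι ω x)
        - algebraMap K _ (ω.form x y) := by
      rw [ι_mul_ι ω hx hy]; abel
    have e2 : ω.form x y • ε (g + h) k • m = ω.form x y • m := by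
      by_cases h0 : g + h = 0
      · rw [h0, ε.zero_left, one_smul]
      · rw [ω.degree_zero hx hy h0, zero_smul, zero_smul]
    have e3 : ι ω (𝔤.bracket x y) • m = ι ω x • ι ω y • m - ε g h • ι ω y • ι ω x • m
        - ω.form x y • m := by
      rw [e1, sub_smul, sub_smul, mul_smul, smul_assoc, mul_smul, algebraMap_smul]
    have e4 : MulOpposite.op (ι ω (𝔤.bracket x y)) • m =
        MulOpposite.op (ι ω y) • MulOpposite.op (ι ω x) • m
        - ε g h • MulOpposite.op (ι ω x) • MulOpposite.op (ι ω y) • m - ω.form x y • m := by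
      rw [e1, MulOpposite.op_sub, MulOpposite.op_sub, MulOpposite.op_smul, MulOpposite.op_mul,
        MulOpposite.op_mul, sub_smul, sub_smul, mul_smul, smul_assoc,
        mul_smul]
      congr 1
      rw [← algebraMap_smul (U ω)ᵐᵒᵖ (ω.form x y) m]
      rfl
    have e5 : ε (g + h) k • ω.form x y • m = ω.form x y • m := by rw [smul_comm, e2]
    have e6 : MulOpposite.op (ι ω x) • ι ω y • m = ι ω y • MulOpposite.op (ι ω x) • m :=
      (smul_comm _ _ _).symm
    have e7 : MulOpposite.op (ι ω y) • ι ω x • m = ι ω x • MulOpposite.op (ι ω y) • m :=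
      (smul_comm _ _ _).symm
    have s := ε.mul_swap g h
    rw [e3, e4]
    simp only [smul_sub, e5, e6, e7]
    simp only [ε.add_left, ε.add_right, smul_smul]
    generalize ε g h = p at *
    generalize ε h g = q at *
    generalize ε g k = a at *
    generalize ε h k = b at *
    generalize (ι ω x * ι ω y) • m = v1
    generalize (ι ω y * ι ω x) • m = v2
    generalize ι ω x • MulOpposite.op (ι ω y) • m = v3
    generalize ι ω y • MulOpposite.op (ι ω x) • m = v4
    generalize (MulOpposite.op (ι ω x) * MulOpposite.op (ι ω y)) • m = v5
    generalize (MulOpposite.op (ι ω y) * MulOpposite.op (ι ω x)) • m = v6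
    have h3 : (p * (q * b)) • v3 = b • v3 := by rw [← mul_assoc, s, one_mul]
    have h6 : (p * (a * (q * b))) • v6 = (a * b) • v6 := by
      rw [show p * (a * (q * b)) = p * q * (a * b) by ring, s, one_mul]
    have h5 : (a * b * p) • v5 = (b * (p * a)) • v5 := by
      rw [show a * b * p = b * (p * a) by ring]
    rw [h3, h6, h5]
    abel

/-- The adjoint graded `L`-module of a graded `U_ω(L)`-bimodule,
`ad(x) m = x m - ε(|x|,|m|) m x` for homogeneous `x ∈ L` and `m ∈ M`. -/
def adjoint : GrRep (0 : 𝔤.Cocycle) where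
  carrier := M.carrier
  deg := M.deg
  isInternal := M.isInternal
  act := ad M
  act_mem := ad_mem M
  act_act hx hy m := by
    rw [ad_ad M hx hy m]
    change _ = _ + (0 : K) • m
    rw [zero_smul, add_zero]

end Adjoint

end ColorLieAlgebra

end Color

end

/-!
Write `A = U_ω(L)`. The isomorphism comes from a pair of adjoint exact functors, and no
Poincaré–Birkhoff–Witt theorem or resolution is needed.

The functor `adjointFunctor`, `M ↦ ᵃᵈM`, from graded `A`-bimodules to graded `L`-modules does not
change the underlying graded vector space, so it preserves surjections. Its left adjoint
`inducedFunctor` takes a graded `L`-module `P` to `P ⊗ A`, on which `A` acts from the right by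
multiplication and `x ∈ L` acts from the left by `x (n ⊗ a) = x n ⊗ a + ε(|x|,|n|) n ⊗ x a`.
The left action satisfies the relations of `A` because `ω` is nonzero only on `L_g × L_{-g}`, where
the factor `ε(g + h, |n|)` that the relation produces is `1`. A bimodule map `φ : P ⊗ A → M` is
determined by `f(n) = φ(n ⊗ 1)`, and it is compatible with the left action of `x` exactly if
`x f(n) = f(x n) + ε(|x|,|n|) f(n) x`, which says that `f` is a map of `L`-modules into `ᵃᵈM`; this is
`inducedAdjunction`. Tensoring over the field `K` preserves injections, so with the one-sided
exactness that adjoints have, both functors are exact.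

Adjoint exact functors induce adjoint functors on derived categories, hence
`Ext(P ⊗ A, M) ≅ Ext(P, ᵃᵈM)` in all degrees (`CategoryTheory.Adjunction.extLinearEquiv`). For the
trivial module `P = K` the induced bimodule is `A` itself (`inducedTrivialIso`).
-/

noncomputable section

/-! ### Exact adjunctions and `Ext` -/

section ExtAdjunction

open Abelian

universe v₁ u₁ v₂ u₂ w₁ w₂

variable {C : Type u₁} [Category.{v₁} C] [Abelian C] {D : Type u₂} [Category.{v₂} D] [Abelian D]
  {S : C ⥤ D} {T : D ⥤ C} (adj : S ⊣ T) [S.Additive] [T.Additive]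

namespace CategoryTheory.Adjunction

/-- An adjunction between additive functors acts degreewise on complexes. -/
def mapCochainComplex :
    S.mapHomologicalComplex (ComplexShape.up ℤ) ⊣ T.mapHomologicalComplex (ComplexShape.up ℤ) :=
  Adjunction.mkOfUnitCounit
    { unit :=
       { app := fun X =>
           { f := fun i => adj.unit.app (X.X i)
             comm' := fun i j _ => (adj.unit.naturality (X.d i j)).symm }
         naturality := fun X Y f => by ext i; exact adj.unit.naturality (f.f i) }
      counit :=
       { app := fun X =>
           { f := fun i => adj.counit.app (X.X i)
             comm' := fun i j _ => (adj.counit.naturality (X.d i j)).symm }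
         naturality := fun X Y f => by ext i; exact adj.counit.naturality (f.f i) }
      left_triangle := by
        ext X i
        simp only [NatTrans.comp_app, HomologicalComplex.comp_f, Functor.whiskerRight_app,
          Functor.whiskerLeft_app, Functor.associator_hom_app,
          Category.id_comp]
        exact adj.left_triangle_components (X.X i)
      right_triangle := by
        ext X i
        simp only [NatTrans.comp_app, HomologicalComplex.comp_f, Functor.whiskerRight_app,
          Functor.whiskerLeft_app, Functor.associator_inv_app,
          Category.id_comp]
        exact adj.right_triangle_components (X.X i) }

variable [PreservesFiniteLimits S] [PreservesFiniteColimits S]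
  [PreservesFiniteLimits T] [PreservesFiniteColimits T]

/-- An adjunction between exact functors passes to the derived categories. -/
def mapDerivedCategory [HasDerivedCategory.{w₁} C] [HasDerivedCategory.{w₂} D] :
    S.mapDerivedCategory ⊣ T.mapDerivedCategory :=
  letI : CatCommSq (S.mapHomologicalComplex (ComplexShape.up ℤ)) DerivedCategory.Q
    DerivedCategory.Q S.mapDerivedCategory := ⟨S.mapDerivedCategoryFactors.symm⟩
  letI : CatCommSq (T.mapHomologicalComplex (ComplexShape.up ℤ)) DerivedCategory.Q
    DerivedCategory.Q T.mapDerivedCategory := ⟨T.mapDerivedCategoryFactors.symm⟩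
  adj.mapCochainComplex.localization DerivedCategory.Q
    (HomologicalComplex.quasiIso C (ComplexShape.up ℤ)) DerivedCategory.Q
    (HomologicalComplex.quasiIso D (ComplexShape.up ℤ)) S.mapDerivedCategory T.mapDerivedCategory

/-- The bijection of an adjunction is linear if the right adjoint is. -/
def homLinearEquiv (R : Type*) [Ring R] {C D : Type*} [Category* C] [Category* D] [Preadditive C]
    [Preadditive D] [Linear R C] [Linear R D] {S : C ⥤ D} {T : D ⥤ C} (adj : S ⊣ T)
    [T.Additive] [T.Linear R] (X : C) (Y : D) : (S.obj X ⟶ Y) ≃ₗ[R] (X ⟶ T.obj Y) :=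
  { adj.homEquiv X Y with
    map_add' := fun f g => by simp [homEquiv_unit]
    map_smul' := fun r f => by simp [homEquiv_unit, Functor.map_smul] }

/-- Adjoint exact functors are adjoint with respect to `Ext`. -/
def extLinearEquiv (R : Type*) [Ring R] [Linear R C] [Linear R D] [T.Linear R]
    [HasExt.{w₁} C] [HasExt.{w₂} D] (X : C) (Y : D) (n : ℕ) :
    Ext (S.obj X) Y n ≃ₗ[R] Ext X (T.obj Y) n :=
  letI := HasDerivedCategory.standard C
  letI := HasDerivedCategory.standard D
  Ext.homLinearEquiv ≪≫ₗ
    Linear.homCongr R ((S.mapDerivedCategorySingleFunctor 0).symm.app X) (Iso.refl _) ≪≫ₗ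
    homLinearEquiv R adj.mapDerivedCategory _ _ ≪≫ₗ
    Linear.homCongr R (Iso.refl _) ((T.mapDerivedCategory.commShiftIso (n : ℤ)).app _ ≪≫
      (shiftFunctor _ (n : ℤ)).mapIso ((T.mapDerivedCategorySingleFunctor 0).app Y)) ≪≫ₗ
    Ext.homLinearEquiv.symm

end CategoryTheory.Adjunction

/-- `Ext` is invariant under isomorphisms in both variables. -/
def CategoryTheory.Abelian.Ext.isoCongr (R : Type*) [Ring R] [Linear R C] [HasExt.{w₁} C]
    {X X' Y Y' : C} (e : X ≅ X') (f : Y ≅ Y') (n : ℕ) : Ext X Y n ≃ₗ[R] Ext X' Y' n :=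
  letI := HasDerivedCategory.standard C
  Ext.homLinearEquiv ≪≫ₗ
    Linear.homCongr R ((DerivedCategory.singleFunctor C 0).mapIso e)
      ((shiftFunctor _ (n : ℤ)).mapIso ((DerivedCategory.singleFunctor C 0).mapIso f)) ≪≫ₗ
    Ext.homLinearEquiv.symm

end ExtAdjunction

/-! ### Maps out of graded spaces, tensor products of graded spaces -/

section GradedSpace

variable {K : Type*} [Field K] {G : Type*} [DecidableEq G] {N : Type*} [AddCommGroup N]
  [Module K N] {Q : Type*} [AddCommGroup Q] [Module K Q]

namespace DirectSum.IsInternal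

variable {𝒩 : G → Submodule K N}

/-- Linear maps out of an internal direct sum that agree on homogeneous elements are equal. -/
theorem linearMap_ext (h : DirectSum.IsInternal 𝒩) {f f' : N →ₗ[K] Q}
    (hf : ∀ g, ∀ n ∈ 𝒩 g, f n = f' n) : f = f' := by
  have : ⨆ g, 𝒩 g ≤ LinearMap.eqLocus f f' := iSup_le fun g n hn => hf g n hn
  exact LinearMap.ext fun n => this (h.submodule_iSup_eq_top ▸ Submodule.mem_top)

/-- The linear map out of an internal direct sum with given restrictions to the components. -/
def lift (h : DirectSum.IsInternal 𝒩) (f : ∀ g, 𝒩 g →ₗ[K] Q) : N →ₗ[K] Q :=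
  letI := h.chooseDecomposition
  DirectSum.toModule K G Q f ∘ₗ (DirectSum.decomposeLinearEquiv 𝒩).toLinearMap

theorem lift_apply (h : DirectSum.IsInternal 𝒩) (f : ∀ g, 𝒩 g →ₗ[K] Q) {g : G} {n : N}
    (hn : n ∈ 𝒩 g) : h.lift f n = f g ⟨n, hn⟩ := by
  let := h.chooseDecomposition
  simp only [lift, LinearMap.comp_apply, LinearEquiv.coe_coe,
    DirectSum.decomposeLinearEquiv_apply, DirectSum.decompose_of_mem 𝒩 hn]
  rw [← DirectSum.lof_eq_of K, DirectSum.toModule_lof]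

theorem tensor_ext {P : Type*} [AddCommGroup P] [Module K P] {𝒬 : G → Submodule K P}
    (h𝒩 : DirectSum.IsInternal 𝒩) (h𝒬 : DirectSum.IsInternal 𝒬) {f f' : N ⊗[K] P →ₗ[K] Q}
    (h : ∀ g k, ∀ n ∈ 𝒩 g, ∀ p ∈ 𝒬 k, f (n ⊗ₜ p) = f' (n ⊗ₜ p)) : f = f' :=
  TensorProduct.ext (h𝒩.linearMap_ext fun g n hn => h𝒬.linearMap_ext fun k p hp => h g k n hn p hp)

end DirectSum.IsInternal

end GradedSpace

section TensorGrading

variable {K : Type*} [Field K] {G : Type*} [AddCommGroup G] {N : Type*}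
  [AddCommGroup N] [Module K N] {P : Type*} [AddCommGroup P] [Module K P]

/-- The grading of a tensor product of graded vector spaces: the component of degree `g` is the sum
over `h` of the images of `N_h ⊗ P_{g - h}`. -/
def tensorGrading (𝒩 : G → Submodule K N) (𝒬 : G → Submodule K P) (g : G) :
    Submodule K (N ⊗[K] P) :=
  ⨆ h : G, Submodule.map₂ (TensorProduct.mk K N P) (𝒩 h) (𝒬 (g - h))

variable {𝒩 : G → Submodule K N} {𝒬 : G → Submodule K P}

theorem tmul_mem_tensorGrading {g h : G} {n : N} {p : P} (hn : n ∈ 𝒩 g) (hp : p ∈ 𝒬 h) :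
    n ⊗ₜ[K] p ∈ tensorGrading 𝒩 𝒬 (g + h) :=
  Submodule.mem_iSup_of_mem g (Submodule.apply_mem_map₂ (TensorProduct.mk K N P) hn
    (by rwa [add_sub_cancel_left]))

theorem tensorGrading_le {g : G} {S : Submodule K (N ⊗[K] P)}
    (hS : ∀ h k, h + k = g → ∀ n ∈ 𝒩 h, ∀ p ∈ 𝒬 k, n ⊗ₜ[K] p ∈ S) :
    tensorGrading 𝒩 𝒬 g ≤ S :=
  iSup_le fun h => Submodule.map₂_le.2 fun n hn p hp => hS h (g - h) (by abel) n hn p hp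

theorem tensorGrading_isInternal [DecidableEq G] (h𝒩 : DirectSum.IsInternal 𝒩)
    (h𝒬 : DirectSum.IsInternal 𝒬) : DirectSum.IsInternal (tensorGrading 𝒩 𝒬) := by
  obtain ⟨q, -, q2, q3, -⟩ := exists_proj h𝒬
  let r : G → N ⊗[K] P →ₗ[K] N ⊗[K] P := fun g => TensorProduct.lift
    (h𝒩.lift fun h => (LinearMap.lcomp K (N ⊗[K] P) (q (g - h))) ∘ₗ
      TensorProduct.mk K N P ∘ₗ (𝒩 h).subtype)
  have hr : ∀ g h, ∀ n ∈ 𝒩 h, ∀ p, r g (n ⊗ₜ p) = n ⊗ₜ q (g - h) p := fun g h n hn p => by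
    simp only [r, TensorProduct.lift.tmul, h𝒩.lift_apply _ hn]
    rfl
  refine isInternal_of_proj _ r (fun g t ht => ?_) (fun g h hgh t ht => ?_) (eq_top_iff.2 ?_)
  · refine tensorGrading_le (S := LinearMap.eqLocus (r g) LinearMap.id) ?_ ht
    rintro h k rfl n hn p hp
    change r _ _ = _
    rw [hr _ h n hn, add_sub_cancel_left, q2 k p hp]
    rfl
  · refine tensorGrading_le (S := LinearMap.ker (r g)) ?_ ht
    rintro i k rfl n hn p hp
    rw [LinearMap.mem_ker, hr _ i n hn, q3 _ k (fun e => hgh ?_) p hp, TensorProduct.tmul_zero]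
    rw [← e, add_sub_cancel]
  · have h0 : (⨆ g, tensorGrading 𝒩 𝒬 g).mkQ = 0 :=
      h𝒩.tensor_ext h𝒬 fun g k n hn p hp =>
        (Submodule.Quotient.mk_eq_zero _).2
          (Submodule.mem_iSup_of_mem (g + k) (tmul_mem_tensorGrading hn hp))
    rw [← Submodule.ker_mkQ (⨆ g, tensorGrading 𝒩 𝒬 g), h0, LinearMap.ker_zero]

end TensorGrading

namespace GrMod

section Morphisms

variable {K : Type k} [Field K] {G : Type w} [AddCommGroup G] [DecidableEq G]
  {A : Type a} [Ring A] [Algebra K A] {𝒜 : G → Submodule K A} {M N : GrMod.{w, v} 𝒜}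

theorem mono_of_injective (f : M ⟶ N) (hf : Function.Injective (lin f)) : Mono f :=
  ⟨fun _ _ h => hom_ext <| LinearMap.ext fun m => hf (congrArg (fun k => lin k m) h)⟩

theorem epi_of_surjective (f : M ⟶ N) (hf : Function.Surjective (lin f)) : Epi f :=
  ⟨fun _ _ h => hom_ext <| LinearMap.ext fun n => by
    obtain ⟨m, rfl⟩ := hf n
    exact congrArg (fun k => lin k m) h⟩

/-- A bijective morphism of graded modules is an isomorphism. -/
def isoOfBijective (f : M ⟶ N) (hf : Function.Bijective (lin f)) : M ≅ N :=
  haveI := mono_of_injective f hf.1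
  haveI := epi_of_surjective f hf.2
  haveI := isIso_of_mono_of_epi f
  asIso f

end Morphisms

end GrMod

/-! ### Modules over `U_ω(L)` and over its enveloping algebra; the adjoint module functor -/

section ColorInduction

variable {K : Type u} [Field K] {G : Type w} [AddCommGroup G] [DecidableEq G]
  {ε : Bicharacter G K} {L : Type u} [AddCommGroup L] [Module K L]
  {ℒ : G → Submodule K L} [DirectSum.Decomposition ℒ]

namespace ColorLieAlgebra

variable {𝔤 : ColorLieAlgebra ε ℒ}

/-- Induction on `U_ω(L)`, which is generated by the homogeneous elements of `L`. -/
theorem induction_on (ω : 𝔤.Cocycle) {p : U ω → Prop} (u : U ω)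
    (scalar : ∀ r : K, p (algebraMap K _ r)) (gen : ∀ g, ∀ x ∈ ℒ g, p (ι ω x))
    (mul : ∀ u v, p u → p v → p (u * v)) (add : ∀ u v, p u → p v → p (u + v)) : p u := by
  obtain ⟨t, rfl⟩ : ∃ t, toU ω t = u := RingQuot.mkAlgHom_surjective K (Rel ω) u
  induction t using TensorAlgebra.induction with
  | algebraMap r => rw [AlgHom.commutes]; exact scalar r
  | add s t hs ht => rw [map_add]; exact add _ _ hs ht
  | mul s t hs ht => rw [map_mul]; exact mul _ _ hs ht
  | ι x =>
    change p (ι ω x)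
    have hx : x ∈ ⨆ g, ℒ g := by
      rw [(DirectSum.Decomposition.isInternal ℒ).submodule_iSup_eq_top]; trivial
    induction hx using Submodule.iSup_induction' with
    | zero => simpa using scalar 0
    | add x y _ _ hx hy => rw [map_add]; exact add _ _ hx hy
    | mem g x hx => exact gen g x hx

/-- A `K`-linear map between modules over `U_ω(L)` that commutes with the action of the homogeneous
elements of `L` commutes with the action of `U_ω(L)`. -/
theorem map_smul_of_map_ι_smul {ω : 𝔤.Cocycle} {M N : GrMod.{w, v} (grading ω)}
    (f : M.carrier →ₗ[K] N.carrier) (hf : ∀ g, ∀ x ∈ ℒ g, ∀ m, f (ι ω x • m) = ι ω x • f m)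
    (u : U ω) (m : M.carrier) : f (u • m) = u • f m := by
  induction u using induction_on ω generalizing m with
  | scalar r => rw [algebraMap_smul, algebraMap_smul, map_smul]
  | gen g x hx => exact hf g x hx m
  | mul u v hu hv => rw [mul_smul, mul_smul, hu, hv]
  | add u v hu hv => rw [add_smul, add_smul, map_add, hu, hv]

/-- Morphisms of graded `U_ω(L)`-modules from maps that commute with the action of the homogeneous
elements of `L`. -/
def homOfι {ω : 𝔤.Cocycle} {M N : GrMod.{w, v} (grading ω)} (f : M.carrier →ₗ[K] N.carrier)
    (hf : ∀ g, ∀ x ∈ ℒ g, ∀ m, f (ι ω x • m) = ι ω x • f m)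
    (hd : ∀ g, ∀ m ∈ M.deg g, f m ∈ N.deg g) : M ⟶ N :=
  GrMod.ofLin { f with map_smul' := map_smul_of_map_ι_smul f hf } hd

theorem toGrMod_ι_smul {ω : 𝔤.Cocycle} (M : GrRep ω) (x : L) (m : M.toGrMod.carrier) :
    ι ω x • m = M.act x m := by
  change M.actU (ι ω x) m = _
  rw [GrRep.actU, lift_ι]

/-- Morphisms of graded `U_ω(L)`-modules from maps that commute with the action of the homogeneous
elements of `L`. -/
def homOfAct {ω : 𝔤.Cocycle} {M N : GrRep ω} (f : M.carrier →ₗ[K] N.carrier)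
    (hf : ∀ g, ∀ x ∈ ℒ g, ∀ m, f (M.act x m) = N.act x (f m))
    (hd : ∀ g, ∀ m ∈ M.deg g, f m ∈ N.deg g) : M.toGrMod ⟶ N.toGrMod :=
  homOfι (M := M.toGrMod) (N := N.toGrMod) f (fun g x hx m =>
    (congrArg f (toGrMod_ι_smul M x m)).trans
      ((hf g x hx m).trans (toGrMod_ι_smul N x (f m)).symm)) hd

end ColorLieAlgebra

namespace GrBimod

variable {A : Type u} [Ring A] [Algebra K A] {𝒜 : G → Submodule K A}

/-- Morphisms of graded modules over `A ⊗ Aᵒᵖ` from maps that commute with both actions of `A`. -/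
def homOfEnv {M N : GrMod.{w, v} (envGrading 𝒜)} (f : M.carrier →ₗ[K] N.carrier)
    (hl : ∀ (a : A) m, f ((a ⊗ₜ[K] (1 : Aᵐᵒᵖ)) • m) = (a ⊗ₜ[K] (1 : Aᵐᵒᵖ)) • f m)
    (hr : ∀ (b : Aᵐᵒᵖ) m, f (((1 : A) ⊗ₜ[K] b) • m) = ((1 : A) ⊗ₜ[K] b) • f m)
    (hd : ∀ g, ∀ m ∈ M.deg g, f m ∈ N.deg g) : M ⟶ N :=
  GrMod.ofLin
    { f with
      map_smul' := fun t m => by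
        change f (t • m) = t • f m
        induction t with
        | zero =>
          exact (congrArg f (zero_smul (A ⊗[K] Aᵐᵒᵖ) m)).trans
            ((map_zero f).trans (zero_smul (A ⊗[K] Aᵐᵒᵖ) (f m)).symm)
        | add s t hs ht => rw [add_smul, add_smul, map_add, hs, ht]
        | tmul a b =>
          have e : a ⊗ₜ[K] b = (a ⊗ₜ[K] (1 : Aᵐᵒᵖ)) * ((1 : A) ⊗ₜ[K] b) := by simp
          rw [e, mul_smul, mul_smul, hl, hr] } hd

/-- The graded bimodule that corresponds to a graded module over `A ⊗ Aᵒᵖ`. -/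
def ofGrMod [SetLike.GradedOne 𝒜] (M : GrMod.{w, u} (envGrading 𝒜)) : GrBimod 𝒜 :=
  letI l : Module A M.carrier := Module.compHom M.carrier
    (Algebra.TensorProduct.includeLeft : A →ₐ[K] A ⊗[K] Aᵐᵒᵖ).toRingHom
  letI r : Module Aᵐᵒᵖ M.carrier := Module.compHom M.carrier
    (Algebra.TensorProduct.includeRight : Aᵐᵒᵖ →ₐ[K] A ⊗[K] Aᵐᵒᵖ).toRingHom
  { carrier := M.carrier
    towerLeft := ⟨fun k a m => by
      change ((k • a) ⊗ₜ[K] (1 : Aᵐᵒᵖ)) • m = k • (a ⊗ₜ[K] (1 : Aᵐᵒᵖ)) • m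
      rw [← smul_assoc, TensorProduct.smul_tmul']⟩
    towerRight := ⟨fun k b m => by
      change ((1 : A) ⊗ₜ[K] (k • b)) • m = k • ((1 : A) ⊗ₜ[K] b) • m
      rw [← smul_assoc, TensorProduct.tmul_smul]⟩
    comm := ⟨fun a b m => by
      change (a ⊗ₜ[K] (1 : Aᵐᵒᵖ)) • ((1 : A) ⊗ₜ[K] b) • m =
        ((1 : A) ⊗ₜ[K] b) • (a ⊗ₜ[K] (1 : Aᵐᵒᵖ)) • m
      rw [smul_smul, smul_smul]
      simp⟩
    deg := M.deg
    isInternal := M.isInternal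
    smul_mem := fun {g h a m} ha hm => M.smul_mem (a := a ⊗ₜ[K] (1 : Aᵐᵒᵖ))
      (Submodule.mem_iSup_of_mem g (Submodule.apply_mem_map₂ (TensorProduct.mk K A Aᵐᵒᵖ) ha
        (Submodule.mem_map_of_mem (f := (MulOpposite.opLinearEquiv K).toLinearMap)
          (show (1 : A) ∈ 𝒜 (g - g) by rw [sub_self]; exact SetLike.GradedOne.one_mem)))) hm
    op_smul_mem := fun {g h a m} ha hm => add_comm g h ▸
      M.smul_mem (a := (1 : A) ⊗ₜ[K] MulOpposite.op a)
      (Submodule.mem_iSup_of_mem 0 (Submodule.apply_mem_map₂ (TensorProduct.mk K A Aᵐᵒᵖ)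
        SetLike.GradedOne.one_mem
        (Submodule.mem_map_of_mem (f := (MulOpposite.opLinearEquiv K).toLinearMap)
          (show a ∈ 𝒜 (g - 0) by rwa [sub_zero])))) hm }

end GrBimod

namespace ColorLieAlgebra

variable {𝔤 : ColorLieAlgebra ε ℒ} {ω : 𝔤.Cocycle}

/-- Maps of graded bimodules commute with the adjoint actions. -/
theorem map_ad {M N : GrBimod (grading ω)} (f : M.carrier →ₗ[K] N.carrier)
    (hl : ∀ (a : U ω) m, f (a • m) = a • f m) (hr : ∀ (b : (U ω)ᵐᵒᵖ) m, f (b • m) = b • f m)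
    (hd : ∀ g, ∀ m ∈ M.deg g, f m ∈ N.deg g) {g : G} {x : L} (hx : x ∈ ℒ g) (m : M.carrier) :
    f (ad M x m) = ad N x (f m) := by
  have : f ∘ₗ ad M x = ad N x ∘ₗ f := M.isInternal.linearMap_ext fun h m hm => by
    simp only [LinearMap.comp_apply, ad_apply M hx hm, ad_apply N hx (hd h m hm), map_sub, map_smul,
      hl, hr]
  exact LinearMap.congr_fun this m

variable (ω) in
/-- The functor from graded bimodules over `U_ω(L)`, considered as modules over the enveloping
algebra, to graded `L`-modules that takes `M` to its adjoint module. -/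
def adjointFunctor : GrMod.{w, u} (envGrading (grading ω)) ⥤
    GrMod.{w, u} (grading (0 : 𝔤.Cocycle)) where
  obj M := (adjoint (GrBimod.ofGrMod M)).toGrMod
  map {M N} f := homOfAct (M := adjoint (GrBimod.ofGrMod M)) (N := adjoint (GrBimod.ofGrMod N))
    ((GrMod.lin f).restrictScalars K)
    (fun _ _ hx m => map_ad (M := GrBimod.ofGrMod M) (N := GrBimod.ofGrMod N)
      ((GrMod.lin f).restrictScalars K) (fun a m => (GrMod.lin f).map_smul _ m)
      (fun b m => (GrMod.lin f).map_smul _ m) (fun _ _ hm => GrMod.lin_mem f hm) hx m)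
    (fun _ _ hm => GrMod.lin_mem f hm)

/-- On graded bimodules the adjoint functor is the adjoint module. -/
def adjointFunctorObjIso (M : GrBimod (grading ω)) :
    (adjointFunctor ω).obj M.toGrMod ≅ (adjoint M).toGrMod :=
  GrMod.isoOfBijective
    (homOfAct (M := adjoint (GrBimod.ofGrMod M.toGrMod)) (N := adjoint M) LinearMap.id
      (fun _ _ hx m => map_ad (M := GrBimod.ofGrMod M.toGrMod) (N := M) LinearMap.id
        (fun a m => congrArg (a • ·) (one_smul (U ω)ᵐᵒᵖ (show M.carrier from m)))
        (fun b m => one_smul (U ω) (b • show M.carrier from m)) (fun _ _ hm => hm) hx m)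
      (fun _ _ hm => hm)) Function.bijective_id

instance : (adjointFunctor ω).Additive where
  map_add := rfl

instance : (adjointFunctor ω).Linear K where
  map_smul _ _ := rfl

instance : (adjointFunctor ω).PreservesEpimorphisms where
  preserves f _ := GrMod.epi_of_surjective _ (GrMod.surjective_of_epi f)

end ColorLieAlgebra
end ColorInduction

/-! ### Induced bimodules -/

section Induced

variable {K : Type u} [Field K] {G : Type w} [AddCommGroup G] [DecidableEq G]
  {ε : Bicharacter G K} {L : Type u} [AddCommGroup L] [Module K L]
  {ℒ : G → Submodule K L} [DirectSum.Decomposition ℒ]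

namespace ColorLieAlgebra

variable {𝔤 : ColorLieAlgebra ε ℒ} (ω : 𝔤.Cocycle) (P : GrMod.{w, u} (grading (0 : 𝔤.Cocycle)))

/-- The operator `n ⊗ a ↦ x n ⊗ a + ε(|x|,|n|) n ⊗ x a` on `P ⊗ U_ω(L)`, extended bilinearly from
homogeneous `x` and `n`. -/
def inducedAct : L →ₗ[K] Module.End K (P.carrier ⊗[K] U ω) :=
  (DirectSum.Decomposition.isInternal ℒ).lift fun g =>
    (LinearMap.rTensorHom (U ω) ∘ₗ (Algebra.lsmul K K P.carrier).toLinearMap ∘ₗ ι (0 : 𝔤.Cocycle) +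
      TensorProduct.mapBilinear (RingHom.id K) P.carrier (U ω) P.carrier (U ω)
          (P.isInternal.lift fun h => ε g h • (P.deg h).subtype) ∘ₗ
        (Algebra.lmul K (U ω)).toLinearMap ∘ₗ ι ω) ∘ₗ (ℒ g).subtype

variable {P} in
theorem inducedAct_tmul {g h : G} {x : L} {n : P.carrier} (hx : x ∈ ℒ g) (hn : n ∈ P.deg h)
    (a : U ω) : inducedAct ω P x (n ⊗ₜ a) = (ι (0 : 𝔤.Cocycle) x • n) ⊗ₜ a + ε g h • n ⊗ₜ (ι ω x * a) := by
  rw [inducedAct, (DirectSum.Decomposition.isInternal ℒ).lift_apply _ hx]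
  change (ι (0 : 𝔤.Cocycle) x • n) ⊗ₜ a + (P.isInternal.lift _ n) ⊗ₜ (ι ω x * a) = _
  rw [P.isInternal.lift_apply _ hn]
  rfl

/-- The left `(ω, L)`-module `P ⊗ U_ω(L)` induced from the graded `L`-module `P`. -/
def inducedRep : GrRep ω where
  carrier := P.carrier ⊗[K] U ω
  deg := tensorGrading P.deg (grading ω)
  isInternal := tensorGrading_isInternal P.isInternal
    (DirectSum.Decomposition.isInternal (grading ω))
  act := inducedAct ω P
  act_mem := fun {g h x t} hx ht => by
    refine tensorGrading_le (S := (tensorGrading P.deg (grading ω) (g + h)).comap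
      (inducedAct ω P x)) ?_ ht
    rintro i j rfl n hn a ha
    rw [Submodule.mem_comap, inducedAct_tmul ω hx hn]
    refine Submodule.add_mem _ ?_ (Submodule.smul_mem _ _ ?_)
    · rw [← add_assoc]
      exact tmul_mem_tensorGrading (P.smul_mem (ι_mem_grading 0 hx) hn) ha
    · rw [add_left_comm]
      exact tmul_mem_tensorGrading hn (SetLike.mul_mem_graded (ι_mem_grading ω hx) ha)
  act_act := fun {g h x y} hx hy t => by
    have key : inducedAct ω P x * inducedAct ω P y - ε g h • (inducedAct ω P y * inducedAct ω P x)
        = inducedAct ω P (𝔤.bracket x y) + ω.form x y • 1 := by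
      refine TensorProduct.ext (P.isInternal.linearMap_ext fun k n hn => LinearMap.ext fun a => ?_)
      have hxn : ι (0 : 𝔤.Cocycle) x • n ∈ P.deg (g + k) := P.smul_mem (ι_mem_grading 0 hx) hn
      have hyn : ι (0 : 𝔤.Cocycle) y • n ∈ P.deg (h + k) := P.smul_mem (ι_mem_grading 0 hy) hn
      change inducedAct ω P x (inducedAct ω P y (n ⊗ₜ a)) -
        ε g h • inducedAct ω P y (inducedAct ω P x (n ⊗ₜ a)) =
        inducedAct ω P (𝔤.bracket x y) (n ⊗ₜ a) + ω.form x y • n ⊗ₜ a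
      rw [inducedAct_tmul ω hx hn, inducedAct_tmul ω hy hn,
        inducedAct_tmul ω (𝔤.bracket_mem hx hy) hn]
      simp only [map_add, map_smul, inducedAct_tmul ω hx hn, inducedAct_tmul ω hy hn,
        inducedAct_tmul ω hx hyn, inducedAct_tmul ω hy hxn]
      -- `ω(x, y)` vanishes unless `g + h = 0`, and then `ε (g + h) k = 1`.
      have e0 : ω.form x y • ε (g + h) k • n ⊗ₜ[K] a = ω.form x y • n ⊗ₜ[K] a := by
        by_cases h0 : g + h = 0
        · rw [h0, ε.zero_left, one_smul]
        · rw [ω.degree_zero hx hy h0, zero_smul, zero_smul]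
      have e1 : (ι (0 : 𝔤.Cocycle) x • ι (0 : 𝔤.Cocycle) y • n) ⊗ₜ[K] a = ε g h • (ι (0 : 𝔤.Cocycle) y • ι (0 : 𝔤.Cocycle) x • n) ⊗ₜ[K] a +
          (ι (0 : 𝔤.Cocycle) (𝔤.bracket x y) • n) ⊗ₜ[K] a := by
        have hf : algebraMap K (U (0 : 𝔤.Cocycle)) ((0 : 𝔤.Cocycle).form x y) = 0 := map_zero _
        rw [← mul_smul, ι_mul_ι 0 hx hy, hf, add_zero, add_smul, smul_assoc, mul_smul,
          TensorProduct.add_tmul, TensorProduct.smul_tmul']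
      have e2 : n ⊗ₜ[K] (ι ω x * (ι ω y * a)) = ε g h • n ⊗ₜ[K] (ι ω y * (ι ω x * a)) +
          n ⊗ₜ[K] (ι ω (𝔤.bracket x y) * a) + ω.form x y • n ⊗ₜ[K] a := by
        rw [← mul_assoc, ι_mul_ι ω hx hy, add_mul, add_mul, smul_mul_assoc, mul_assoc,
          ← Algebra.smul_def, TensorProduct.tmul_add, TensorProduct.tmul_add,
          TensorProduct.tmul_smul, TensorProduct.tmul_smul]
      conv_rhs => rw [← e0]
      rw [e1, e2]
      have s := ε.mul_swap g h
      simp only [smul_add, ε.add_left, ε.add_right, smul_smul]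
      generalize ε g h = p at *
      generalize ε h g = q at *
      generalize ε g k = b at *
      generalize ε h k = c at *
      generalize (ι (0 : 𝔤.Cocycle) y • ι (0 : 𝔤.Cocycle) x • n) ⊗ₜ[K] a = v1
      generalize (ι (0 : 𝔤.Cocycle) x • n) ⊗ₜ[K] (ι ω y * a) = v2
      -- The mixed terms of the two compositions cancel because `ε g h * ε h g = 1`.
      have h2 : (p * (q * c)) • v2 = c • v2 := by rw [← mul_assoc, s, one_mul]
      rw [h2]
      module
    exact LinearMap.congr_fun key t

/-- Right multiplication of `U_ω(L)` on `P ⊗ U_ω(L)`. -/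
def inducedRight : (U ω)ᵐᵒᵖ →ₐ[K] Module.End K (P.carrier ⊗[K] U ω) :=
  (Module.End.lTensorAlgHom K (U ω) P.carrier).comp (Algebra.lsmul K K (U ω))

theorem inducedRight_tmul (b : (U ω)ᵐᵒᵖ) (n : P.carrier) (a : U ω) :
    inducedRight ω P b (n ⊗ₜ a) = n ⊗ₜ (b • a) := rfl

theorem inducedAct_inducedRight {g : G} {x : L} (hx : x ∈ ℒ g) (b : (U ω)ᵐᵒᵖ)
    (t : P.carrier ⊗[K] U ω) :
    inducedRight ω P b (inducedAct ω P x t) = inducedAct ω P x (inducedRight ω P b t) := by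
  have : inducedRight ω P b ∘ₗ inducedAct ω P x = inducedAct ω P x ∘ₗ inducedRight ω P b :=
    TensorProduct.ext (P.isInternal.linearMap_ext fun k n hn => LinearMap.ext fun a => by
      change inducedRight ω P b (inducedAct ω P x (n ⊗ₜ a)) =
        inducedAct ω P x (inducedRight ω P b (n ⊗ₜ a))
      rw [inducedRight_tmul, inducedAct_tmul ω hx hn, inducedAct_tmul ω hx hn, map_add, map_smul,
        inducedRight_tmul, inducedRight_tmul, mul_smul_comm])
  exact LinearMap.congr_fun this t

theorem inducedRight_smul (a : U ω) (b : (U ω)ᵐᵒᵖ) (t : (inducedRep ω P).toGrMod.carrier) :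
    (inducedRight ω P b (a • t) : (inducedRep ω P).toGrMod.carrier) =
      a • (show (inducedRep ω P).toGrMod.carrier from inducedRight ω P b t) :=
  map_smul_of_map_ι_smul (M := (inducedRep ω P).toGrMod) (N := (inducedRep ω P).toGrMod)
    (inducedRight ω P b) (fun _ x hx m =>
      (congrArg (inducedRight ω P b) (toGrMod_ι_smul (inducedRep ω P) x m)).trans
        ((inducedAct_inducedRight ω P hx b m).trans
          (toGrMod_ι_smul (inducedRep ω P) x _).symm)) a t

/-- The graded bimodule `P ⊗ U_ω(L)` induced from the graded `L`-module `P`: the right action is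
right multiplication, the left action is `x (n ⊗ a) = x n ⊗ a + ε(|x|,|n|) n ⊗ x a`. -/
def induced : GrBimod (grading ω) :=
  letI l : Module (U ω) (P.carrier ⊗[K] U ω) := (inducedRep ω P).toGrMod.module
  letI r : Module (U ω)ᵐᵒᵖ (P.carrier ⊗[K] U ω) :=
    Module.compHom _ (inducedRight ω P).toRingHom
  { carrier := P.carrier ⊗[K] U ω
    towerLeft := (inducedRep ω P).toGrMod.isScalarTower
    towerRight := ⟨fun c b t => by
      change inducedRight ω P (c • b) t = c • inducedRight ω P b t
      rw [map_smul, LinearMap.smul_apply]⟩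
    comm := ⟨fun a b t => (inducedRight_smul ω P a b t).symm⟩
    deg := tensorGrading P.deg (grading ω)
    isInternal := (inducedRep ω P).isInternal
    smul_mem := (inducedRep ω P).toGrMod.smul_mem
    op_smul_mem := fun {g h b t} hb ht => by
      refine tensorGrading_le (S := (tensorGrading P.deg (grading ω) (h + g)).comap
        (inducedRight ω P (MulOpposite.op b))) ?_ ht
      rintro i j rfl n hn a ha
      rw [Submodule.mem_comap, inducedRight_tmul, add_assoc]
      exact tmul_mem_tensorGrading hn (SetLike.mul_mem_graded ha hb) }

theorem induced_ι_smul {g h : G} {x : L} {n : P.carrier} (hx : x ∈ ℒ g) (hn : n ∈ P.deg h)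
    (a : U ω) : (ι ω x • (show (induced ω P).carrier from n ⊗ₜ a) : (induced ω P).carrier) =
      (ι (0 : 𝔤.Cocycle) x • n) ⊗ₜ[K] a + ε g h • n ⊗ₜ[K] (ι ω x * a) :=
  (toGrMod_ι_smul (inducedRep ω P) x (n ⊗ₜ[K] a)).trans (inducedAct_tmul ω hx hn a)

end ColorLieAlgebra
end Induced

/-! ### Bimodule maps out of an induced bimodule -/

section InductionFunctor

namespace GrBimod

variable {K : Type u} [Field K] {G : Type w} [AddCommGroup G] [DecidableEq G]
  {A : Type u} [Ring A] [Algebra K A] {𝒜 : G → Submodule K A}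

theorem toGrMod_tmul_one_smul (M : GrBimod 𝒜) (a : A) (m : M.toGrMod.carrier) :
    (a ⊗ₜ[K] (1 : Aᵐᵒᵖ)) • m = a • (show M.carrier from m) :=
  congrArg (a • ·) (one_smul Aᵐᵒᵖ (show M.carrier from m))

theorem toGrMod_one_tmul_smul (M : GrBimod 𝒜) (b : Aᵐᵒᵖ) (m : M.toGrMod.carrier) :
    ((1 : A) ⊗ₜ[K] b) • m = b • (show M.carrier from m) :=
  one_smul A (b • show M.carrier from m)

end GrBimod

variable {K : Type u} [Field K] {G : Type w} [AddCommGroup G] [DecidableEq G]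
  {ε : Bicharacter G K} {L : Type u} [AddCommGroup L] [Module K L]
  {ℒ : G → Submodule K L} [DirectSum.Decomposition ℒ]

namespace ColorLieAlgebra

variable {𝔤 : ColorLieAlgebra ε ℒ} {ω : 𝔤.Cocycle} {P : GrMod.{w, u} (grading (0 : 𝔤.Cocycle))}
  {M : GrMod.{w, u} (envGrading (grading ω))}

/-- The graded left module that underlies a graded module over the enveloping algebra. -/
def leftModule (M : GrMod.{w, u} (envGrading (grading ω))) : GrMod.{w, u} (grading ω) where
  carrier := M.carrier
  module := (GrBimod.ofGrMod M).moduleLeft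
  isScalarTower := (GrBimod.ofGrMod M).towerLeft
  deg := M.deg
  isInternal := M.isInternal
  smul_mem := (GrBimod.ofGrMod M).smul_mem

/-- Morphisms out of the bimodule induced from `P`. -/
def homOfInduced (f : P.carrier ⊗[K] U ω →ₗ[K] M.carrier)
    (hl : ∀ g h, ∀ x ∈ ℒ g, ∀ n ∈ P.deg h, ∀ a,
      f ((ι (0 : 𝔤.Cocycle) x • n) ⊗ₜ a) + ε g h • f (n ⊗ₜ (ι ω x * a)) =
        (ι ω x ⊗ₜ[K] (1 : (U ω)ᵐᵒᵖ)) • f (n ⊗ₜ a))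
    (hr : ∀ (b : (U ω)ᵐᵒᵖ) n a, f (n ⊗ₜ (b • a)) = ((1 : U ω) ⊗ₜ[K] b) • f (n ⊗ₜ a))
    (hd : ∀ g h, ∀ n ∈ P.deg g, ∀ a ∈ grading ω h, f (n ⊗ₜ a) ∈ M.deg (g + h)) :
    (induced ω P).toGrMod ⟶ M :=
  GrBimod.homOfEnv (M := (induced ω P).toGrMod) f
    (fun a t => by
      have key := map_smul_of_map_ι_smul (M := (inducedRep ω P).toGrMod) (N := leftModule M) f
        (fun g x hx m => by
          have : f ∘ₗ inducedAct ω P x =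
              Algebra.lsmul K K M.carrier (ι ω x ⊗ₜ[K] (1 : (U ω)ᵐᵒᵖ)) ∘ₗ f :=
            TensorProduct.ext (P.isInternal.linearMap_ext fun k n hn => LinearMap.ext fun a => by
              change f (inducedAct ω P x (n ⊗ₜ a)) =
                (ι ω x ⊗ₜ[K] (1 : (U ω)ᵐᵒᵖ)) • f (n ⊗ₜ a)
              rw [inducedAct_tmul ω hx hn, map_add, map_smul, hl g k x hx n hn])
          exact (congrArg f (toGrMod_ι_smul (inducedRep ω P) x m)).trans
            (LinearMap.congr_fun this m)) a t
      exact (congrArg f ((induced ω P).toGrMod_tmul_one_smul a t)).trans key)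
    (fun b t => by
      have : f ∘ₗ inducedRight ω P b = Algebra.lsmul K K M.carrier ((1 : U ω) ⊗ₜ[K] b) ∘ₗ f :=
        TensorProduct.ext' fun n a => hr b n a
      exact (congrArg f ((induced ω P).toGrMod_one_tmul_smul b t)).trans
        (LinearMap.congr_fun this t))
    (fun g t ht => by
      refine tensorGrading_le (S := (M.deg g).comap f) ?_ ht
      rintro h k rfl n hn a ha
      exact hd h k n hn a ha)

/-- A bimodule map out of `P ⊗ U_ω(L)` is determined by its values on `P ⊗ 1`. -/
theorem lin_induced_tmul (φ : (induced ω P).toGrMod ⟶ M) (n : P.carrier) (a : U ω) :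
    GrMod.lin φ (n ⊗ₜ[K] a : P.carrier ⊗[K] U ω) =
      ((1 : U ω) ⊗ₜ[K] MulOpposite.op a) • GrMod.lin φ (n ⊗ₜ[K] 1 : P.carrier ⊗[K] U ω) := by
  refine Eq.trans (congrArg (GrMod.lin φ) ?_) ((GrMod.lin φ).map_smul _ _)
  refine Eq.trans ?_ ((induced ω P).toGrMod_one_tmul_smul _ _).symm
  change n ⊗ₜ[K] a = n ⊗ₜ[K] (1 * a)
  rw [one_mul]

/-- Compatibility of a bimodule map out of `P ⊗ U_ω(L)` with the left action of `L`. -/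
theorem lin_induced_ι_tmul (φ : (induced ω P).toGrMod ⟶ M) {g h : G} {x : L} {n : P.carrier}
    (hx : x ∈ ℒ g) (hn : n ∈ P.deg h) (a : U ω) :
    (ι ω x ⊗ₜ[K] (1 : (U ω)ᵐᵒᵖ)) • GrMod.lin φ (n ⊗ₜ[K] a : P.carrier ⊗[K] U ω) =
      GrMod.lin φ ((ι (0 : 𝔤.Cocycle) x • n) ⊗ₜ[K] a : P.carrier ⊗[K] U ω) +
        ε g h • GrMod.lin φ (n ⊗ₜ[K] (ι ω x * a) : P.carrier ⊗[K] U ω) := by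
  refine ((GrMod.lin φ).map_smul _ _).symm.trans ?_
  have e := ((induced ω P).toGrMod_tmul_one_smul (ι ω x) (n ⊗ₜ[K] a : P.carrier ⊗[K] U ω)).trans
    (induced_ι_smul ω P hx hn a)
  refine (congrArg (GrMod.lin φ) e).trans ?_
  exact (map_add ((GrMod.lin φ).restrictScalars K) _ _).trans
    (congrArg _ (map_smul ((GrMod.lin φ).restrictScalars K) _ _))

theorem induced_hom_ext {φ ψ : (induced ω P).toGrMod ⟶ M}
    (h : ∀ n : P.carrier, GrMod.lin φ (n ⊗ₜ[K] 1 : P.carrier ⊗[K] U ω) =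
      GrMod.lin ψ (n ⊗ₜ[K] 1 : P.carrier ⊗[K] U ω)) : φ = ψ := by
  have : (GrMod.lin φ).restrictScalars K = (GrMod.lin ψ).restrictScalars K :=
    TensorProduct.ext' (M := P.carrier) (N := U ω) fun n a =>
      (lin_induced_tmul φ n a).trans ((congrArg _ (h n)).trans (lin_induced_tmul ψ n a).symm)
  exact GrMod.hom_ext (LinearMap.ext fun t => LinearMap.congr_fun this t)

variable (ω) in
/-- The functor `P ↦ P ⊗ U_ω(L)` from graded `L`-modules to graded bimodules over `U_ω(L)`. -/
def inducedFunctor : GrMod.{w, u} (grading (0 : 𝔤.Cocycle)) ⥤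
    GrMod.{w, u} (envGrading (grading ω)) where
  obj P := (induced ω P).toGrMod
  map {P Q} f := homOfInduced (M := (induced ω Q).toGrMod)
    (((GrMod.lin f).restrictScalars K).rTensor (U ω))
    (fun g h x hx n hn a => by
      refine Eq.trans ?_ (((induced ω Q).toGrMod_tmul_one_smul (ι ω x)
        (GrMod.lin f n ⊗ₜ[K] a : Q.carrier ⊗[K] U ω)).trans
        (induced_ι_smul ω Q hx (GrMod.lin_mem f hn) a)).symm
      change (GrMod.lin f (ι 0 x • n)) ⊗ₜ[K] a + _ = _
      rw [map_smul]
      rfl)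
    (fun b n a => ((induced ω Q).toGrMod_one_tmul_smul b
      (GrMod.lin f n ⊗ₜ[K] a : Q.carrier ⊗[K] U ω)).symm)
    (fun g h n hn a ha => tmul_mem_tensorGrading (GrMod.lin_mem f hn) ha)
  map_id P := induced_hom_ext fun n => rfl
  map_comp f g := induced_hom_ext fun n => rfl

theorem adjoint_ofGrMod_act {g h : G} {x : L} {m : M.carrier} (hx : x ∈ ℒ g) (hm : m ∈ M.deg h) :
    (adjoint (GrBimod.ofGrMod M)).act x m = (ι ω x ⊗ₜ[K] (1 : (U ω)ᵐᵒᵖ)) • m -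
      ε g h • ((1 : U ω) ⊗ₜ[K] MulOpposite.op (ι ω x)) • m :=
  ad_apply (GrBimod.ofGrMod M) hx hm

/-- Restriction of a bimodule map `P ⊗ U_ω(L) → M` to `P`. -/
def restrictInduced (φ : (induced ω P).toGrMod ⟶ M) : P ⟶ (adjointFunctor ω).obj M :=
  homOfι (N := (adjointFunctor ω).obj M)
    ((GrMod.lin φ).restrictScalars K ∘ₗ (TensorProduct.mk K P.carrier (U ω)).flip 1)
    (fun g x hx m => by
      have hdeg : ∀ k, ∀ n ∈ P.deg k, GrMod.lin φ (n ⊗ₜ[K] 1 : P.carrier ⊗[K] U ω) ∈ M.deg k :=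
        fun k n hn => GrMod.lin_mem φ (by
          have := tmul_mem_tensorGrading hn (SetLike.GradedOne.one_mem (A := grading ω))
          rwa [add_zero] at this)
      have : ((GrMod.lin φ).restrictScalars K ∘ₗ (TensorProduct.mk K P.carrier (U ω)).flip 1) ∘ₗ
            Algebra.lsmul K K P.carrier (ι (0 : 𝔤.Cocycle) x) =
          (adjoint (GrBimod.ofGrMod M)).act x ∘ₗ
            (GrMod.lin φ).restrictScalars K ∘ₗ (TensorProduct.mk K P.carrier (U ω)).flip 1 :=
        P.isInternal.linearMap_ext fun k n hn => by
          refine Eq.trans ?_ (adjoint_ofGrMod_act hx (hdeg k n hn)).symm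
          rw [lin_induced_ι_tmul φ hx hn, ← lin_induced_tmul, mul_one]
          exact (add_sub_cancel_right _ _).symm
      exact (LinearMap.congr_fun this m).trans
        (toGrMod_ι_smul (adjoint (GrBimod.ofGrMod M)) x _).symm)
    (fun g n hn => GrMod.lin_mem φ (by
      have := tmul_mem_tensorGrading hn (SetLike.GradedOne.one_mem (A := grading ω))
      rwa [add_zero] at this))

/-- Extension of a map of graded `L`-modules `P → M`, for the adjoint action on the bimodule `M`, to
a bimodule map on `P ⊗ U_ω(L)`. -/
def extendInduced (f : P ⟶ (adjointFunctor ω).obj M) : (induced ω P).toGrMod ⟶ M :=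
  let f' : P.carrier →ₗ[K] M.carrier := (GrMod.lin f).restrictScalars K
  homOfInduced (TensorProduct.lift (LinearMap.mk₂ K
      (fun n a => ((1 : U ω) ⊗ₜ[K] MulOpposite.op a) • f' n)
      (fun n n' a => by rw [map_add, smul_add])
      (fun c n a => by rw [map_smul, smul_comm])
      (fun n a a' => by rw [MulOpposite.op_add, TensorProduct.tmul_add, add_smul])
      (fun c n a => by rw [MulOpposite.op_smul, TensorProduct.tmul_smul, smul_assoc])))
    (fun g h x hx n hn a => by
      simp only [TensorProduct.lift.tmul, LinearMap.mk₂_apply]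
      have e : f' (ι (0 : 𝔤.Cocycle) x • n) = (ι ω x ⊗ₜ[K] (1 : (U ω)ᵐᵒᵖ)) • f' n -
          ε g h • ((1 : U ω) ⊗ₜ[K] MulOpposite.op (ι ω x)) • f' n :=
        ((GrMod.lin f).map_smul _ _).trans
          ((toGrMod_ι_smul (adjoint (GrBimod.ofGrMod M)) x (f' n)).trans
            (adjoint_ofGrMod_act hx (GrMod.lin_mem f hn)))
      rw [e, smul_sub, smul_comm _ (ε g h), smul_smul, smul_smul, smul_smul,
        Algebra.TensorProduct.tmul_mul_tmul, Algebra.TensorProduct.tmul_mul_tmul,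
        Algebra.TensorProduct.tmul_mul_tmul, MulOpposite.op_mul]
      simp only [one_mul, mul_one, sub_add_cancel])
    (fun b n a => by
      simp only [TensorProduct.lift.tmul, LinearMap.mk₂_apply, smul_smul,
        Algebra.TensorProduct.tmul_mul_tmul, one_mul]
      rfl)
    (fun g h n hn a ha => (GrBimod.ofGrMod M).op_smul_mem ha (GrMod.lin_mem f hn))

end ColorLieAlgebra
end InductionFunctor

/-! ### The adjunction and its exactness -/

section AdjointInduced

variable {K : Type u} [Field K] {G : Type w} [AddCommGroup G] [DecidableEq G]
  {ε : Bicharacter G K} {L : Type u} [AddCommGroup L] [Module K L]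
  {ℒ : G → Submodule K L} [DirectSum.Decomposition ℒ]

namespace ColorLieAlgebra

variable {𝔤 : ColorLieAlgebra ε ℒ} (ω : 𝔤.Cocycle)

/-- Induction is left adjoint to the adjoint module functor. -/
def inducedAdjunction : inducedFunctor ω ⊣ adjointFunctor ω :=
  Adjunction.mkOfHomEquiv
    { homEquiv := fun _ M =>
        { toFun := restrictInduced
          invFun := extendInduced
          left_inv := fun φ => induced_hom_ext fun n =>
            (lin_induced_tmul φ n 1).symm
          right_inv := fun f => GrMod.hom_ext <| LinearMap.ext fun n =>
            one_smul (U ω ⊗[K] (U ω)ᵐᵒᵖ) (show M.carrier from GrMod.lin f n) }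
      homEquiv_naturality_left_symm := fun _ _ => induced_hom_ext fun _ => rfl
      homEquiv_naturality_right := fun _ _ => rfl }

instance : (inducedFunctor ω).Additive := (inducedAdjunction ω).left_adjoint_additive

instance : (inducedFunctor ω).PreservesMonomorphisms where
  preserves f _ := GrMod.mono_of_injective _
    (Module.Flat.rTensor_preserves_injective_linearMap (M := U ω)
      ((GrMod.lin f).restrictScalars K) (GrMod.injective_of_mono f))

instance : PreservesFiniteColimits (inducedFunctor ω) :=
  have := (inducedAdjunction ω).leftAdjoint_preservesColimits
  inferInstance

instance : PreservesFiniteLimits (adjointFunctor ω) :=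
  have := (inducedAdjunction ω).rightAdjoint_preservesLimits
  inferInstance

/-- A left adjoint that preserves monomorphisms is exact. -/
instance : PreservesFiniteLimits (inducedFunctor ω) :=
  (Functor.preservesFiniteLimits_iff_forall_exact_map_and_mono _).2 fun S hS =>
    have := hS.mono_f
    ⟨((Functor.preservesFiniteColimits_iff_forall_exact_map_and_epi _).1 inferInstance S hS).1,
      inferInstance⟩

/-- A right adjoint that preserves epimorphisms is exact. -/
instance : PreservesFiniteColimits (adjointFunctor ω) :=
  (Functor.preservesFiniteColimits_iff_forall_exact_map_and_epi _).2 fun S hS =>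
    have := hS.epi_g
    ⟨((Functor.preservesFiniteLimits_iff_forall_exact_map_and_mono _).1 inferInstance S hS).1,
      inferInstance⟩

theorem trivialRep_eq_zero {g : G} {n : K} (hn : n ∈ (trivialRep 𝔤).deg g) (hg : g ≠ 0) : n = 0 := by
  change n ∈ (if g = 0 then ⊤ else ⊥ : Submodule K K) at hn
  rwa [if_neg hg] at hn

/-- The bimodule induced from the trivial `L`-module is `U_ω(L)`. -/
def inducedTrivialIso : (inducedFunctor ω).obj (trivialRep 𝔤).toGrMod ≅
    (GrBimod.regular (grading ω)).toGrMod :=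
  GrMod.isoOfBijective
    (homOfInduced (P := (trivialRep 𝔤).toGrMod) (M := (GrBimod.regular (grading ω)).toGrMod)
      (TensorProduct.lid K (U ω)).toLinearMap
      (fun g h x hx n hn a => by
        have e1 : TensorProduct.lid K (U ω) ((ι (0 : 𝔤.Cocycle) x • n) ⊗ₜ a) = 0 :=
          (congrArg (fun k : K => k • a) (toGrMod_ι_smul (trivialRep 𝔤) x n)).trans (zero_smul K a)
        -- The trivial module lives in degree `0`, so the factor `ε(|x|,|n|)` is `1`.
        have e2 : ε g h * (show K from n) = n := by
          by_cases h0 : h = 0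
          · have := ε.mul_swap g h
            rw [h0, ε.zero_left, mul_one] at this
            rw [h0, this, one_mul]
          · have : n = 0 := trivialRep_eq_zero (𝔤 := 𝔤) hn h0
            rw [this]
            exact mul_zero _
        refine Eq.trans ?_ ((GrBimod.regular (grading ω)).toGrMod_tmul_one_smul _ _).symm
        change TensorProduct.lid K (U ω) ((ι (0 : 𝔤.Cocycle) x • n) ⊗ₜ a) +
          ε g h • (show K from n) • (ι ω x * a) = ι ω x * (show K from n) • a
        rw [e1, zero_add, smul_smul, e2, mul_smul_comm])
      (fun b n a => by
        refine Eq.trans ?_ ((GrBimod.regular (grading ω)).toGrMod_one_tmul_smul _ _).symm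
        exact (smul_comm b (show K from n) a).symm)
      (fun g h n hn a ha => by
        have key : (show K from n) • a ∈ grading ω (g + h) := by
          by_cases h0 : g = 0
          · rw [h0, zero_add]
            exact Submodule.smul_mem _ _ ha
          · have : n = 0 := trivialRep_eq_zero (𝔤 := 𝔤) hn h0
            rw [this]
            exact (zero_smul K a).symm ▸ Submodule.zero_mem _
        exact key))
    (TensorProduct.lid K (U ω)).bijective

end ColorLieAlgebra
end AdjointInduced

end

theorem theorem4p2 {K : Type u} [Field K] [CharZero K] {G : Type w} [AddCommGroup G]
    [DecidableEq G] (ε : Bicharacter G K) {L : Type u} [AddCommGroup L] [Module K L]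
    (ℒ : G → Submodule K L) [DirectSum.Decomposition ℒ] (𝔤 : ColorLieAlgebra ε ℒ)
    (ω : 𝔤.Cocycle) (M : GrBimod (ColorLieAlgebra.grading ω)) (n : ℕ) :
    Nonempty (ColorLieAlgebra.Cohomology (ColorLieAlgebra.adjoint M) n ≃ₗ[K]
      GrHH (ColorLieAlgebra.grading ω) M n) := by
  let i := ColorLieAlgebra.inducedTrivialIso ω
  let j := ColorLieAlgebra.adjointFunctorObjIso M
  exact ⟨(Abelian.Ext.isoCongr K (Iso.refl _) j n).symm ≪≫ₗ
    ((ColorLieAlgebra.inducedAdjunction ω).extLinearEquiv K _ M.toGrMod n).symm ≪≫ₗ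
    Abelian.Ext.isoCongr K i (Iso.refl _) n⟩
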